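/- Let $r,n\ge 0$ be integers and let $L_1,\dots,L_n$ be linear forms on $\mathbb Q^r$; for a field $K\supseteq\mathbb Q$, regard them also as linear forms on $K^r$. For a subset $\Omega\subseteq K^r$ let $U(\Omega)\subseteq \mathrm{GL}_r(K)$ be its stabilizer, acting on linear forms on $K^r$ by $u\cdot\ell=\ell\circ u^{-1}$. Suppose that the system $L_1(X)\overset{d}{=}\cdots\overset{d}{=}L_n(X)$ is ellipsoidal over $\mathbb Q$ in the following sense. (a) For every prime $p$ we are given a lattice $\Omega_p\subseteq\mathbb Q_p^r$ (a finitely generated $\mathbb Z_p$-submodule spanning $\mathbb Q_p^r$) such that $L_1,\dots,L_n$ lie in a single orbit of $U(\Omega_p)$, and $\Omega_p=\mathbb Z_p^r$ for all but finitely many $p$. (b) $Q$ is a positive definite quadratic form on $\mathbb R^r$ that is defined over $\mathbb Q$ (it extends a quadratic form on $\mathbb Q^r$), $\Omega_{\mathbb R}$ is the solid ellipsoid with boundary $Q(x)=1$ (either the closed one $\{x: Q(x)\le 1\}$ or the open one $\{x: Q(x)<1\}$), and $L_1,\dots,L_n$ lie in a single orbit of $U(\Omega_{\mathbb R})$. Let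 $\Lambda$ be the set of $x\in\mathbb Q^r$ that lie in $\Omega_p$ for every prime $p$, and for real $D>0$ let $\Omega_{\mathbb Q}(D)=\Lambda\cap D\,\Omega_{\mathbb R}$. Then $\Omega_{\mathbb Q}(D)$ is finite and non-empty for every $D>0$, and there is a constant $C$ (independent of $D$, $i$, $j$ and $y$) such that for every real $D>0$, all $i,j\in\{1,\dots,n\}$ and all $y\in\mathbb Q$, a random variable $X$ uniformly distributed on $\Omega_{\mathbb Q}(D)$ satisfies $$\bigl|\Pr(L_i(X)=y)-\Pr(L_j(X)=y)\bigr|\le C D^{-2}.$$ -/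

import Mathlib

open scoped Pointwise

namespace NonDet

/-- The coordinatewise embedding `ℚ^r → K^r` for a field `K` containing `ℚ`. -/
def coordEmb (K : Type*) [Field K] [Algebra ℚ K] {r : ℕ} (x : Fin r → ℚ) : Fin r → K :=
  fun k => algebraMap ℚ K (x k)

/-- The extension of scalars to `K` of a linear form on `ℚ^r`: the linear form on `K^r` with the
same coefficients. -/
def formOver (K : Type*) [Field K] [Algebra ℚ K] {r : ℕ} (L : Module.Dual ℚ (Fin r → ℚ)) :
    Module.Dual K (Fin r → K) :=
  ∑ k : Fin r, algebraMap ℚ K (L (Pi.single k 1)) • LinearMap.proj k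

theorem formOver_coordEmb (K : Type*) [Field K] [Algebra ℚ K] {r : ℕ}
    (L : Module.Dual ℚ (Fin r → ℚ)) (x : Fin r → ℚ) :
    formOver K L (coordEmb K x) = algebraMap ℚ K (L x) := by
  conv_rhs => rw [LinearMap.pi_apply_eq_sum_univ L x]
  simp only [formOver, coordEmb, LinearMap.sum_apply, LinearMap.smul_apply, LinearMap.proj_apply,
    smul_eq_mul, map_sum, map_mul]
  refine Finset.sum_congr rfl fun k _ => ?_
  have h : (Pi.single k 1 : Fin r → ℚ) = fun j => if k = j then 1 else 0 := by
    funext j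
    simp [Pi.single_apply, eq_comm]
  rw [h, mul_comm]

/-- The unitary group `U(Ω)`: the stabilizer of `Ω ⊆ K^r` in `GL_r(K)`. -/
def unitaryGroup {K : Type*} [Field K] {r : ℕ} (Ω : Set (Fin r → K)) :
    Subgroup ((Fin r → K) ≃ₗ[K] (Fin r → K)) :=
  MulAction.stabilizer ((Fin r → K) ≃ₗ[K] (Fin r → K)) Ω

/-- The linear forms `ℓ i` on `K^r` lie in a single orbit of `U(Ω)`, acting on linear forms by the
dual action `(u, ℓ) ↦ ℓ ∘ u⁻¹`. -/
def InSingleOrbit {K : Type*} [Field K] {r n : ℕ} (Ω : Set (Fin r → K))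
    (ℓ : Fin n → Module.Dual K (Fin r → K)) : Prop :=
  ∀ i j, ∃ u ∈ unitaryGroup Ω, ℓ j = (ℓ i).comp (u⁻¹ : (Fin r → K) ≃ₗ[K] (Fin r → K)).toLinearMap

/-- The standard lattice `ℤ_p^r` in `ℚ_p^r`. -/
noncomputable def standardLattice (p : ℕ) [Fact p.Prime] (r : ℕ) : Submodule ℤ_[p] (Fin r → ℚ_[p]) :=
  Submodule.pi Set.univ fun _ => (1 : Submodule ℤ_[p] ℚ_[p])

/-- A real quadratic form on `ℝ^r` is defined over `ℚ` if it extends a quadratic form on `ℚ^r`. -/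
def IsDefinedOverRat {r : ℕ} (Q : QuadraticForm ℝ (Fin r → ℝ)) : Prop :=
  ∃ Q₀ : QuadraticForm ℚ (Fin r → ℚ), ∀ x : Fin r → ℚ, Q (coordEmb ℝ x) = (Q₀ x : ℝ)

/-- `Ω` is the solid ellipsoid with boundary `Q(x) = 1`, taken either with or without its
boundary. -/
def IsEllipsoidOf {r : ℕ} (Q : QuadraticForm ℝ (Fin r → ℝ)) (Ω : Set (Fin r → ℝ)) : Prop :=
  Ω = {x | Q x ≤ 1} ∨ Ω = {x | Q x < 1}

/-- The lattice `Λ ⊆ ℚ^r` of all `x` that lie in `Ω_p` for every prime `p`. -/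
def globalLattice {r : ℕ} (Ω : ∀ (p : ℕ) [Fact p.Prime], Submodule ℤ_[p] (Fin r → ℚ_[p])) :
    AddSubgroup (Fin r → ℚ) where
  carrier := {x | ∀ (p : ℕ) [Fact p.Prime], coordEmb ℚ_[p] x ∈ Ω p}
  zero_mem' := by
    intro p _
    have h : coordEmb ℚ_[p] (0 : Fin r → ℚ) = 0 := by
      funext k
      simp [coordEmb]
    rw [h]
    exact (Ω p).zero_mem
  add_mem' := by
    intro x y hx hy p _
    have h : coordEmb ℚ_[p] (x + y) = coordEmb ℚ_[p] x + coordEmb ℚ_[p] y := by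
      funext k
      simp [coordEmb]
    rw [h]
    exact (Ω p).add_mem (hx p) (hy p)
  neg_mem' := by
    intro x hx p _
    have h : coordEmb ℚ_[p] (-x) = -coordEmb ℚ_[p] x := by
      funext k
      simp [coordEmb]
    rw [h]
    exact (Ω p).neg_mem (hx p)

/-- `Ω_ℚ(D)`: the points of `Λ` that lie in the dilated ellipsoid `D Ω_ℝ`. -/
def ratPoints {r : ℕ} (Ω : ∀ (p : ℕ) [Fact p.Prime], Submodule ℤ_[p] (Fin r → ℚ_[p]))
    (Ωreal : Set (Fin r → ℝ)) (D : ℝ) : Set (Fin r → ℚ) :=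
  {x | x ∈ globalLattice Ω ∧ coordEmb ℝ x ∈ D • Ωreal}

end NonDet

open MeasureTheory

namespace NonDet

/-! If one form vanishes, the orbit condition makes all of them vanish. Otherwise the argument rests
on a local-global statement and a volume comparison.

The local conditions make `Λ` a lattice in `ℚ^r`, squeezed between two multiples of `ℤ^r`
(`isLattice_globalLattice`). Each `L i` maps it onto a cyclic group, and the p-adic orbit conditions
force these groups to coincide (`map_globalLattice_le`); let `g` be a common generator. Values
outside `ℤ g` are never attained. For `y = t g`, a basis of `Λ` with one vector sent to `g` and the
others spanning the kernel (`exists_adapted_basis`) identifies the points with `L i x = y` with the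
integer points of a slice of dimension `r - 1` of a linear image of the ellipsoid.

Such a slice is convex and has size `O(D)`, so its number of integer points is its volume up to
`O(D^(r-2))` (`abs_ncard_intPoints_sub_volume_le`). The volumes for `i` and `j` are equal: an
element of the real unitary group taking `L i` to `L j` has determinant `±1`, and any two bases of
`Λ` have the same covolume (`volume_headSlice_eq`). Hence the two counts differ by `O(D^(r-2))`.
Since there are at least a constant times `D^r` points in all
(`exists_mul_pow_le_ncard_lattice_inter`), division gives `O(D^(-2))` for `D ≥ 1`; for `D < 1` the
bound is trivial. -/

/-! ### Integer points in bounded convex sets -/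

theorem abs_ncard_int_sub_volume_le_one {J : Set ℝ} (hJ : J.OrdConnected)
    (hbb : BddBelow J) (hba : BddAbove J) :
    |({n : ℤ | (n : ℝ) ∈ J}.ncard : ℝ) - volume.real J| ≤ 1 := by
  rcases J.eq_empty_or_nonempty with rfl | hne
  · simp
  set a := sInf J
  set b := sSup J
  have hsub : J ⊆ Set.Icc a b := fun x hx => ⟨csInf_le hbb hx, le_csSup hba hx⟩
  have hsup : Set.Ioo a b ⊆ J := by
    intro x hx
    obtain ⟨u, hu, hux⟩ := exists_lt_of_csInf_lt hne hx.1
    obtain ⟨v, hv, hxv⟩ := exists_lt_of_lt_csSup hne hx.2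
    exact hJ.out hu hv ⟨hux.le, hxv.le⟩
  have hab : a ≤ b := by
    obtain ⟨x, hx⟩ := hne
    exact (hsub hx).1.trans (hsub hx).2
  have hvol : volume.real J = b - a := by
    have h1 : volume J ≤ ENNReal.ofReal (b - a) := by
      simpa using measure_mono (μ := volume) hsub
    have h2 : ENNReal.ofReal (b - a) ≤ volume J := by
      simpa using measure_mono (μ := volume) hsup
    rw [Measure.real, le_antisymm h1 h2, ENNReal.toReal_ofReal (by linarith)]
  have hfin : (Set.Icc ⌈a⌉ ⌊b⌋).Finite := Set.finite_Icc _ _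
  have hup : {n : ℤ | (n : ℝ) ∈ J} ⊆ Set.Icc ⌈a⌉ ⌊b⌋ := fun n hn =>
    ⟨Int.ceil_le.2 (hsub hn).1, Int.le_floor.2 (hsub hn).2⟩
  have hlo : Set.Ioo ⌊a⌋ ⌈b⌉ ⊆ {n : ℤ | (n : ℝ) ∈ J} := fun n hn =>
    hsup ⟨Int.floor_lt.1 hn.1, Int.lt_ceil.1 hn.2⟩
  have c1 := Set.ncard_le_ncard hup hfin
  have c2 := Set.ncard_le_ncard hlo (hfin.subset hup)
  rw [← Finset.coe_Icc, Set.ncard_coe_finset, Int.card_Icc] at c1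
  rw [← Finset.coe_Ioo, Set.ncard_coe_finset, Int.card_Ioo] at c2
  have d1 : (({n : ℤ | (n : ℝ) ∈ J}.ncard : ℤ) : ℝ) ≤ (max (⌊b⌋ + 1 - ⌈a⌉) 0 : ℤ) := by
    exact_mod_cast by omega
  have d2 : ((⌈b⌉ - ⌊a⌋ - 1 : ℤ) : ℝ) ≤ (({n : ℤ | (n : ℝ) ∈ J}.ncard : ℤ) : ℝ) := by
    exact_mod_cast by omega
  push_cast at d1 d2
  rw [hvol, abs_le]
  have := Int.floor_le b
  have := Int.le_ceil a
  have := Int.floor_le a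
  have := Int.le_ceil b
  constructor
  · linarith
  · have : max ((⌊b⌋ : ℝ) + 1 - ⌈a⌉) 0 ≤ b - a + 1 := max_le (by linarith) (by linarith)
    linarith

/-- The integer points of a subset of `ℝ^m`. -/
def intPoints {m : ℕ} (K : Set (Fin m → ℝ)) : Set (Fin m → ℤ) :=
  {z | (fun k => (z k : ℝ)) ∈ K}

/-- The slice of `K ⊆ ℝ^(m+1)` at first coordinate `t`. -/
def headSlice {m : ℕ} (K : Set (Fin (m + 1) → ℝ)) (t : ℝ) : Set (Fin m → ℝ) :=
  {x | Fin.cons t x ∈ K}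

/-- The slice of `K ⊆ ℝ^(m+1)` at the last `m` coordinates `x`. -/
def tailSlice {m : ℕ} (K : Set (Fin (m + 1) → ℝ)) (x : Fin m → ℝ) : Set ℝ :=
  {t | Fin.cons t x ∈ K}

theorem intPoints_finite {m : ℕ} {K : Set (Fin m → ℝ)} {R : ℝ}
    (hK : ∀ x ∈ K, ∀ k, |x k| ≤ R) : (intPoints K).Finite := by
  refine (Set.Finite.pi' (t := fun _ => Set.Icc ⌈-R⌉ ⌊R⌋) fun _ => Set.finite_Icc _ _).subset ?_
  intro z hz k
  have := abs_le.1 (hK _ hz k)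
  exact ⟨Int.ceil_le.2 this.1, Int.le_floor.2 this.2⟩

theorem measurable_finCons {m : ℕ} :
    Measurable fun p : ℝ × (Fin m → ℝ) => (Fin.cons p.1 p.2 : Fin (m + 1) → ℝ) := by
  refine measurable_pi_lambda _ fun k => ?_
  refine Fin.cases ?_ (fun k => ?_) k
  · simpa using measurable_fst
  · simp only [Fin.cons_succ]
    fun_prop

theorem measurePreserving_finCons (m : ℕ) :
    MeasurePreserving (fun p : ℝ × (Fin m → ℝ) => (Fin.cons p.1 p.2 : Fin (m + 1) → ℝ)) := by
  have h := (volume_preserving_piFinSuccAbove (fun _ : Fin (m + 1) => ℝ) 0).symm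
  convert h using 1
  funext p
  simp [MeasurableEquiv.piFinSuccAbove]
  rfl

theorem convex_headSlice {m : ℕ} {K : Set (Fin (m + 1) → ℝ)} (hK : Convex ℝ K) (t : ℝ) :
    Convex ℝ (headSlice K t) := by
  intro x hx y hy a b ha hb hab
  have h := hK hx hy ha hb hab
  have e : a • (Fin.cons t x : Fin (m + 1) → ℝ) + b • (Fin.cons t y : Fin (m + 1) → ℝ)
      = Fin.cons t (a • x + b • y) := by
    funext k
    refine Fin.cases ?_ (fun k => ?_) k
    · simp [← add_mul, hab]
    · simp
  rw [e] at h
  exact h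

theorem convex_tailSlice {m : ℕ} {K : Set (Fin (m + 1) → ℝ)} (hK : Convex ℝ K)
    (x : Fin m → ℝ) : Convex ℝ (tailSlice K x) := by
  intro s hs t ht a b ha hb hab
  have h := hK hs ht ha hb hab
  have e : a • (Fin.cons s x : Fin (m + 1) → ℝ) + b • (Fin.cons t x : Fin (m + 1) → ℝ)
      = Fin.cons (a • s + b • t) x := by
    funext k
    refine Fin.cases ?_ (fun k => ?_) k
    · simp
    · simp [← add_mul, hab]
  rw [e] at h
  exact h

theorem measurableSet_headSlice {m : ℕ} {K : Set (Fin (m + 1) → ℝ)} (hK : MeasurableSet K)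
    (t : ℝ) : MeasurableSet (headSlice K t) :=
  (measurable_finCons.comp measurable_prodMk_left) hK

theorem headSlice_bound {m : ℕ} {K : Set (Fin (m + 1) → ℝ)} {R : ℝ}
    (hK : ∀ x ∈ K, ∀ k, |x k| ≤ R) (t : ℝ) : ∀ x ∈ headSlice K t, ∀ k, |x k| ≤ R := by
  intro x hx k
  simpa using hK _ hx k.succ

theorem tailSlice_bound {m : ℕ} {K : Set (Fin (m + 1) → ℝ)} {R : ℝ}
    (hK : ∀ x ∈ K, ∀ k, |x k| ≤ R) (x : Fin m → ℝ) : tailSlice K x ⊆ Set.Icc (-R) R := by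
  intro t ht
  simpa [abs_le] using hK _ ht 0

theorem tailSlice_eq_empty {m : ℕ} {K : Set (Fin (m + 1) → ℝ)} {R : ℝ}
    (hK : ∀ x ∈ K, ∀ k, |x k| ≤ R) {x : Fin m → ℝ}
    (hx : x ∉ Set.univ.pi fun _ => Set.Icc (-R) R) : tailSlice K x = ∅ := by
  refine Set.eq_empty_of_forall_notMem fun t ht => hx fun k _ => ?_
  simpa [abs_le] using hK _ ht k.succ

theorem ncard_intPoints_eq_sum {m : ℕ} {K : Set (Fin (m + 1) → ℝ)} {R : ℝ}
    (hK : ∀ x ∈ K, ∀ k, |x k| ≤ R) :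
    (intPoints K).ncard = ∑ t ∈ Finset.Icc ⌈-R⌉ ⌊R⌋, (intPoints (headSlice K t)).ncard := by
  classical
  have hf := intPoints_finite hK
  rw [Set.ncard_eq_toFinset_card _ hf,
    Finset.card_eq_sum_card_fiberwise (f := fun z => z 0) (t := Finset.Icc ⌈-R⌉ ⌊R⌋)]
  · refine Finset.sum_congr rfl fun t _ => ?_
    rw [← Set.ncard_image_of_injective (intPoints (headSlice K t))
      (f := fun z => (Fin.cons t z : Fin (m + 1) → ℤ)) (fun a b h => (Fin.cons_inj.1 h).2),
      ← Set.ncard_coe_finset]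
    congr 1
    have e : ∀ z : Fin m → ℤ, (fun k => ((Fin.cons t z : Fin (m + 1) → ℤ) k : ℝ)) =
        Fin.cons (t : ℝ) fun k => (z k : ℝ) := by
      intro z
      funext k
      refine Fin.cases ?_ (fun k => ?_) k <;> simp
    ext z
    simp only [Finset.coe_filter, Set.Finite.mem_toFinset, Set.mem_ofPred_eq, Set.mem_image]
    constructor
    · rintro ⟨hz, rfl⟩
      refine ⟨Fin.tail z, ?_, Fin.cons_self_tail z⟩
      change Fin.cons _ _ ∈ K
      rw [← e, Fin.cons_self_tail]
      exact hz
    · rintro ⟨w, hw, rfl⟩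
      refine ⟨?_, by simp⟩
      change (fun k => _) ∈ K
      rw [e]
      exact hw
  · intro z hz
    have hz' : (fun k => (z k : ℝ)) ∈ K := hf.mem_toFinset.1 hz
    have := abs_le.1 (hK _ hz' 0)
    simpa using ⟨Int.ceil_le.2 this.1, Int.le_floor.2 this.2⟩

theorem volume_box_lt_top {m : ℕ} (R : ℝ) :
    volume (Set.univ.pi fun _ : Fin m => Set.Icc (-R) R) < ⊤ :=
  (isCompact_univ_pi fun _ => isCompact_Icc).measure_lt_top

theorem volumeReal_eq_integral_tailSlice {m : ℕ} {K : Set (Fin (m + 1) → ℝ)} {R : ℝ}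
    (hm : MeasurableSet K) (hK : ∀ x ∈ K, ∀ k, |x k| ≤ R) :
    volume.real K = ∫ x : Fin m → ℝ, volume.real (tailSlice K x) := by
  have hmK := measurable_finCons (m := m) hm
  have h1 : volume K = ∫⁻ x : Fin m → ℝ, volume (tailSlice K x) := by
    rw [← (measurePreserving_finCons m).measure_preimage hm.nullMeasurableSet, Measure.volume_eq_prod,
      Measure.prod_apply_symm hmK]
    rfl
  have h2 : ∀ x, volume (tailSlice K x) < ⊤ := fun x =>
    (measure_mono (tailSlice_bound hK x)).trans_lt (by simp)
  rw [Measure.real, h1, ← integral_toReal _ (Filter.Eventually.of_forall h2)]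
  · rfl
  · exact (measurable_measure_prodMk_right hmK).aemeasurable

theorem ncard_tailSlice_eq_sum {m : ℕ} {K : Set (Fin (m + 1) → ℝ)} {R : ℝ}
    (hK : ∀ x ∈ K, ∀ k, |x k| ≤ R) (x : Fin m → ℝ) :
    ({n : ℤ | (n : ℝ) ∈ tailSlice K x}.ncard : ℝ) =
      ∑ t ∈ Finset.Icc ⌈-R⌉ ⌊R⌋, (headSlice K t).indicator (1 : (Fin m → ℝ) → ℝ) x := by
  classical
  have : {n : ℤ | (n : ℝ) ∈ tailSlice K x} =
      ((Finset.Icc ⌈-R⌉ ⌊R⌋).filter fun t : ℤ => x ∈ headSlice K t : Finset ℤ) := by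
    ext n
    simp only [Set.mem_ofPred_eq, Finset.coe_filter, Finset.mem_Icc]
    refine ⟨fun h => ⟨?_, h⟩, fun h => h.2⟩
    have := tailSlice_bound hK x h
    exact ⟨Int.ceil_le.2 this.1, Int.le_floor.2 this.2⟩
  rw [this, Set.ncard_coe_finset, Finset.card_filter]
  push_cast
  exact Finset.sum_congr rfl fun t _ => by simp [Set.indicator_apply]

/-- The number of integer points in a bounded convex set differs from its volume by at most the
order of its surface area. -/
theorem abs_ncard_intPoints_sub_volume_le {m : ℕ} {K : Set (Fin m → ℝ)} {R : ℝ} (hR : 0 ≤ R)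
    (hc : Convex ℝ K) (hm : MeasurableSet K) (hK : ∀ x ∈ K, ∀ k, |x k| ≤ R) :
    |((intPoints K).ncard : ℝ) - volume.real K| ≤ m * (2 * R + 1) ^ (m - 1) := by
  induction m with
  | zero =>
    rcases K.eq_empty_or_nonempty with rfl | ⟨x, hx⟩
    · simp [intPoints]
    · have : K = Set.univ := Set.eq_univ_of_forall fun y => Subsingleton.elim x y ▸ hx
      subst this
      have h : volume (Set.univ : Set (Fin 0 → ℝ)) = 1 := by
        rw [← Set.pi_univ Set.univ, volume_pi_pi]
        simp
      simp [intPoints, Measure.real, h]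
  | succ m ih =>
    set T := Finset.Icc ⌈-R⌉ ⌊R⌋
    have hT : (T.card : ℝ) ≤ 2 * R + 1 := by
      have h1 : (T.card : ℤ) = max (⌊R⌋ + 1 - ⌈-R⌉) 0 := by simp [T]
      have h2 : (T.card : ℝ) = max (⌊R⌋ + 1 - ⌈-R⌉ : ℝ) 0 := by exact_mod_cast h1
      rw [h2]
      exact max_le (by linarith [Int.floor_le R, Int.le_ceil (-R)]) (by linarith)
    set B : Set (Fin m → ℝ) := Set.univ.pi fun _ => Set.Icc (-R) R
    have hBm : MeasurableSet B := MeasurableSet.univ_pi fun _ => measurableSet_Icc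
    have hBv : volume.real B = (2 * R) ^ m := by
      simp only [B, Measure.real, volume_pi_pi, Real.volume_Icc, Finset.prod_const,
        Finset.card_univ, Fintype.card_fin, ENNReal.toReal_pow]
      rw [ENNReal.toReal_ofReal (by linarith)]
      ring
    have hfin : ∀ t, volume (headSlice K t) ≠ ⊤ := fun t =>
      ((measure_mono (t := B) fun x hx k _ => abs_le.1 (headSlice_bound hK t x hx k)).trans_lt
        (volume_box_lt_top R)).ne
    -- Induction applies to each slice at an integer height, and there are at most `2 * R + 1` such
    -- heights.
    have step1 : |((intPoints K).ncard : ℝ) - ∑ t ∈ T, volume.real (headSlice K t)| ≤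
        m * (2 * R + 1) ^ m := by
      rw [ncard_intPoints_eq_sum hK, Nat.cast_sum, ← Finset.sum_sub_distrib]
      refine (Finset.abs_sum_le_sum_abs _ _).trans ?_
      refine (Finset.sum_le_card_nsmul T _ _ fun t _ => ih (convex_headSlice hc t)
        (measurableSet_headSlice hm t) (headSlice_bound hK t)).trans ?_
      rw [nsmul_eq_mul]
      refine (mul_le_mul_of_nonneg_right hT (by positivity)).trans_eq ?_
      cases m with
      | zero => simp
      | succ m => simp only [Nat.add_sub_cancel]; ring
    have hint : ∀ t ∈ T,
        Integrable ((headSlice K (t : ℝ)).indicator (1 : (Fin m → ℝ) → ℝ)) := fun t _ =>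
      (integrable_indicator_iff (measurableSet_headSlice hm t)).2
        (integrableOn_const (hfin t))
    -- Exchanging sum and integral turns the total slice volume into the integral, over lines
    -- parallel to the first axis, of the number of integer heights on the line.
    have hs : ∑ t ∈ T, volume.real (headSlice K t) =
        ∫ x, ({n : ℤ | (n : ℝ) ∈ tailSlice K x}.ncard : ℝ) := by
      simp_rw [ncard_tailSlice_eq_sum hK]
      rw [integral_finsetSum _ hint]
      exact Finset.sum_congr rfl fun t _ =>
        (integral_indicator_one (measurableSet_headSlice hm t)).symm
    have hsint : Integrable fun x => ({n : ℤ | (n : ℝ) ∈ tailSlice K x}.ncard : ℝ) := by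
      simp_rw [ncard_tailSlice_eq_sum hK]
      exact integrable_finsetSum _ hint
    have hvint : Integrable fun x => volume.real (tailSlice K x) := by
      have hmeas : Measurable fun x => volume.real (tailSlice K x) :=
        (measurable_measure_prodMk_right (measurable_finCons hm)).ennreal_toReal
      refine ((integrable_indicator_iff hBm).2
        (integrableOn_const (C := 2 * R) (volume_box_lt_top R).ne)).mono'
        hmeas.aestronglyMeasurable (Filter.Eventually.of_forall fun x => ?_)
      by_cases hx : x ∈ B
      · rw [Set.indicator_of_mem hx, Real.norm_of_nonneg measureReal_nonneg]
        refine (measureReal_mono (tailSlice_bound hK x) (by simp)).trans_eq ?_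
        rw [Real.volume_real_Icc_of_le (by linarith)]
        ring
      · rw [Set.indicator_of_notMem hx, tailSlice_eq_empty hK hx]
        simp
    -- Each line meets `K` in an interval, where count and length differ by at most 1. Both vanish
    -- off the box `B`, so the total error is at most the volume of `B`.
    have step2 : |∑ t ∈ T, volume.real (headSlice K t) - volume.real K| ≤ (2 * R) ^ m := by
      rw [hs, volumeReal_eq_integral_tailSlice hm hK, ← integral_sub hsint hvint, ← hBv,
        ← integral_indicator_one hBm, ← Real.norm_eq_abs]
      refine norm_integral_le_of_norm_le ((integrable_indicator_iff hBm).2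
        (integrableOn_const (volume_box_lt_top R).ne)) (Filter.Eventually.of_forall fun x => ?_)
      by_cases hx : x ∈ B
      · rw [Set.indicator_of_mem hx, Real.norm_eq_abs]
        exact abs_ncard_int_sub_volume_le_one (convex_tailSlice hc x).ordConnected
          (bddBelow_Icc.mono (tailSlice_bound hK x)) (bddAbove_Icc.mono (tailSlice_bound hK x))
      · rw [Set.indicator_of_notMem hx, tailSlice_eq_empty hK hx]
        simp
    have h3 : (2 * R) ^ m ≤ (2 * R + 1) ^ m := pow_le_pow_left₀ (by linarith) (by linarith) _
    have := abs_sub_le ((intPoints K).ncard : ℝ) (∑ t ∈ T, volume.real (headSlice K t))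
      (volume.real K)
    simp only [Nat.add_sub_cancel]
    push_cast
    linarith

/-! ### Lattices over the p-adic integers -/

theorem coordEmb_add (K : Type*) [Field K] [Algebra ℚ K] {r : ℕ} (x y : Fin r → ℚ) :
    coordEmb K (x + y) = coordEmb K x + coordEmb K y :=
  funext fun k => map_add (algebraMap ℚ K) (x k) (y k)

theorem coordEmb_smul (K : Type*) [Field K] [Algebra ℚ K] {r : ℕ} (c : ℚ) (x : Fin r → ℚ) :
    coordEmb K (c • x) = algebraMap ℚ K c • coordEmb K x :=
  funext fun k => map_mul (algebraMap ℚ K) c (x k)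

theorem mem_standardLattice {p : ℕ} [Fact p.Prime] {r : ℕ} {x : Fin r → ℚ_[p]} :
    x ∈ standardLattice p r ↔ ∀ k, ‖x k‖ ≤ 1 := by
  simp only [standardLattice, Submodule.mem_pi, Set.mem_univ, true_imp_iff, Submodule.mem_one]
  refine forall_congr' fun k => ⟨?_, fun h => ⟨⟨x k, h⟩, rfl⟩⟩
  rintro ⟨y, hy⟩
  rw [← hy]
  exact y.2

theorem exists_norm_pow_mul_le_one (p : ℕ) [hp : Fact p.Prime] (a : ℚ_[p]) :
    ∃ k : ℕ, ‖(p : ℚ_[p]) ^ k * a‖ ≤ 1 := by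
  obtain ⟨k, hk⟩ := exists_pow_lt_of_lt_one (x := (‖a‖ + 1)⁻¹) (by positivity)
    (Padic.norm_p_lt_one (p := p))
  refine ⟨k, ?_⟩
  rw [norm_mul, norm_pow]
  have h : ‖(p : ℚ_[p])‖ ^ k * (‖a‖ + 1) < 1 := by
    rwa [← one_div, lt_div_iff₀ (by positivity)] at hk
  nlinarith [norm_nonneg a, pow_nonneg (norm_nonneg (p : ℚ_[p])) k]

theorem norm_natCast_le_one (p : ℕ) [Fact p.Prime] (n : ℕ) : ‖(n : ℚ_[p])‖ ≤ 1 := by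
  simpa using Padic.norm_int_le_one (p := p) n

theorem norm_prime_pow_le_one (p : ℕ) [Fact p.Prime] (k : ℕ) : ‖(p : ℚ_[p]) ^ k‖ ≤ 1 := by
  rw [norm_pow]
  exact pow_le_one₀ (norm_nonneg _) Padic.norm_p_lt_one.le

theorem smul_mem_of_norm_le_one {p : ℕ} [Fact p.Prime] {r : ℕ}
    {M : Submodule ℤ_[p] (Fin r → ℚ_[p])} {x : Fin r → ℚ_[p]} (hx : x ∈ M) {a : ℚ_[p]}
    (ha : ‖a‖ ≤ 1) : a • x ∈ M :=
  M.smul_mem (⟨a, ha⟩ : ℤ_[p]) hx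

section Local

variable {p : ℕ} [hp : Fact p.Prime] {r : ℕ} {M : Submodule ℤ_[p] (Fin r → ℚ_[p])}

theorem exists_pow_smul_mem_of_isLattice (hM : Submodule.IsLattice ℚ_[p] M)
    (v : Fin r → ℚ_[p]) :
    ∃ k : ℕ, (p : ℚ_[p]) ^ k • v ∈ M := by
  have hv : v ∈ Submodule.span ℚ_[p] (M : Set (Fin r → ℚ_[p])) := by
    rw [hM.span_eq_top]
    trivial
  induction hv using Submodule.span_induction with
  | mem x hx => exact ⟨0, by simpa using hx⟩
  | zero => exact ⟨0, by simp⟩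
  | add x y _ _ hx hy =>
    obtain ⟨k, hk⟩ := hx
    obtain ⟨l, hl⟩ := hy
    refine ⟨k + l, ?_⟩
    rw [smul_add]
    refine M.add_mem ?_ ?_
    · rw [add_comm, pow_add, mul_smul]
      exact smul_mem_of_norm_le_one hk (norm_prime_pow_le_one p l)
    · rw [pow_add, mul_smul]
      exact smul_mem_of_norm_le_one hl (norm_prime_pow_le_one p k)
  | smul a x _ hx =>
    obtain ⟨k, hk⟩ := hx
    obtain ⟨l, hl⟩ := exists_norm_pow_mul_le_one p a
    refine ⟨l + k, ?_⟩
    rw [smul_smul, pow_add, mul_right_comm, mul_smul]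
    exact smul_mem_of_norm_le_one hk hl

theorem exists_pow_smul_integral_mem (hM : Submodule.IsLattice ℚ_[p] M) :
    ∃ k : ℕ, ∀ x : Fin r → ℚ_[p], (∀ i, ‖x i‖ ≤ 1) → (p : ℚ_[p]) ^ k • x ∈ M := by
  choose k hk using fun i : Fin r =>
    exists_pow_smul_mem_of_isLattice hM (Pi.single i (1 : ℚ_[p]))
  -- The sum of the exponents is at least each of them, so it serves all standard basis vectors at
  -- once.
  refine ⟨∑ i, k i, fun x hx => ?_⟩
  rw [pi_eq_sum_univ' x, Finset.smul_sum]
  refine M.sum_mem fun i hi => ?_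
  rw [smul_comm]
  refine smul_mem_of_norm_le_one ?_ (hx i)
  rw [← Finset.sum_erase_add _ _ hi, pow_add, mul_smul]
  refine smul_mem_of_norm_le_one ?_ (norm_prime_pow_le_one p _)
  exact hk i

theorem exists_norm_le_of_fg (hM : M.FG) :
    ∃ C : ℝ, ∀ x ∈ M, ∀ i, ‖x i‖ ≤ C := by
  induction M, hM using Submodule.fg_induction with
  | singleton x =>
    refine ⟨‖x‖, fun y hy i => ?_⟩
    obtain ⟨a, rfl⟩ := Submodule.mem_span_singleton.1 hy
    change ‖(a : ℚ_[p]) * x i‖ ≤ _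
    rw [norm_mul]
    exact (mul_le_of_le_one_left (norm_nonneg _) a.2).trans (norm_le_pi_norm x i)
  | sup N₁ N₂ _ _ h₁ h₂ =>
    obtain ⟨C₁, h₁⟩ := h₁
    obtain ⟨C₂, h₂⟩ := h₂
    refine ⟨max C₁ C₂, fun y hy i => ?_⟩
    obtain ⟨y₁, hy₁, y₂, hy₂, rfl⟩ := Submodule.mem_sup.1 hy
    exact (Padic.nonarchimedean _ _).trans (max_le_max (h₁ _ hy₁ i) (h₂ _ hy₂ i))

theorem exists_norm_pow_mul_coord_le_one (hM : Submodule.IsLattice ℚ_[p] M) :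
    ∃ k : ℕ, ∀ x ∈ M, ∀ i, ‖(p : ℚ_[p]) ^ k * x i‖ ≤ 1 := by
  obtain ⟨C, hC⟩ := exists_norm_le_of_fg hM.fg
  obtain ⟨a, ha⟩ := NormedField.exists_lt_norm ℚ_[p] C
  obtain ⟨k, hk⟩ := exists_norm_pow_mul_le_one p a
  refine ⟨k, fun x hx i => ?_⟩
  rw [norm_mul] at hk ⊢
  exact (mul_le_mul_of_nonneg_left ((hC x hx i).trans ha.le) (norm_nonneg _)).trans hk

end Local

/-! ### From the local lattices to a lattice in `ℚ^r` -/

theorem den_eq_one_of_padic_norm_le_one {q : ℚ}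
    (h : ∀ (p : ℕ) [Fact p.Prime], ‖(q : ℚ_[p])‖ ≤ 1) : q.den = 1 := by
  by_contra hd
  obtain ⟨p, hp, hpd⟩ := Nat.exists_prime_and_dvd hd
  have : Fact p.Prime := ⟨hp⟩
  have h1 : ‖(q.den : ℚ_[p])‖ < 1 := Padic.norm_natCast_lt_one_iff.2 hpd
  have h2 : ‖(q.num : ℚ_[p])‖ < 1 := by
    have e : (q.num : ℚ_[p]) = (q : ℚ_[p]) * (q.den : ℚ_[p]) := by
      exact_mod_cast congrArg (Rat.cast : ℚ → ℚ_[p]) (Rat.mul_den_eq_num q).symm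
    rw [e, norm_mul]
    nlinarith [h p, norm_nonneg (q : ℚ_[p]), norm_nonneg (q.den : ℚ_[p])]
  have h3 : p ∣ q.num.natAbs := Int.natCast_dvd.1 (Padic.norm_intCast_lt_one_iff.1 h2)
  exact hp.one_lt.ne' (Nat.dvd_one.1 (q.reduced ▸ Nat.dvd_gcd h3 hpd))

theorem exists_natCast_prod_prime_pow_eq_mul {S : Finset ℕ} {k : ℕ → ℕ} {p : ℕ}
    [Fact p.Prime] (hpS : p ∈ S) : ∃ a : ℚ_[p], ‖a‖ ≤ 1 ∧
      ((∏ q ∈ S, q ^ k q : ℕ) : ℚ_[p]) = a * (p : ℚ_[p]) ^ k p := by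
  refine ⟨((∏ q ∈ S.erase p, q ^ k q : ℕ) : ℚ_[p]), norm_natCast_le_one p _, ?_⟩
  rw [← Finset.prod_erase_mul _ _ hpS]
  push_cast
  rfl

section Global

variable {r : ℕ} {Ω : ∀ (p : ℕ) [Fact p.Prime], Submodule ℤ_[p] (Fin r → ℚ_[p])}

/-- Take for `N` the product of the local powers over the finitely many exceptional primes: at each
of these the remaining factors are p-adic integers, and elsewhere integrality suffices. -/
theorem exists_natCast_smul_mem_globalLattice
    (hΩ : ∀ (p : ℕ) [Fact p.Prime], Submodule.IsLattice ℚ_[p] (Ω p))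
    (hS : {p : ℕ | ∃ _ : Fact p.Prime, Ω p ≠ standardLattice p r}.Finite) :
    ∃ N : ℕ, N ≠ 0 ∧ ∀ x : Fin r → ℚ, (∀ i, (x i).den = 1) → (N : ℚ) • x ∈ globalLattice Ω := by
  have hk : ∀ p : ℕ, ∃ k : ℕ, ∀ _ : Fact p.Prime, ∀ x : Fin r → ℚ_[p], (∀ i, ‖x i‖ ≤ 1) →
      (p : ℚ_[p]) ^ k • x ∈ Ω p := by
    intro p
    by_cases hp : p.Prime
    · have : Fact p.Prime := ⟨hp⟩
      obtain ⟨k, hk⟩ := exists_pow_smul_integral_mem (hΩ p)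
      exact ⟨k, fun _ => hk⟩
    · exact ⟨0, fun h => absurd h.out hp⟩
  choose k hk using hk
  have hprime : ∀ p ∈ hS.toFinset, p ≠ 0 := by
    intro p hp
    obtain ⟨h, _⟩ := hS.mem_toFinset.1 hp
    exact h.out.ne_zero
  refine ⟨∏ q ∈ hS.toFinset, q ^ k q,
    Finset.prod_ne_zero_iff.2 fun q hq => pow_ne_zero _ (hprime q hq), fun x hx p hp => ?_⟩
  rw [coordEmb_smul]
  have hxi : ∀ i, ‖coordEmb ℚ_[p] x i‖ ≤ 1 := fun i =>
    Padic.norm_rat_le_one (by rw [hx i]; exact hp.out.one_lt.ne' ∘ Nat.dvd_one.1)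
  by_cases hpS : p ∈ hS.toFinset
  · obtain ⟨a, ha, e⟩ := exists_natCast_prod_prime_pow_eq_mul (k := k) hpS
    rw [map_natCast, e, mul_smul]
    exact smul_mem_of_norm_le_one (hk p hp _ hxi) ha
  · have h : Ω p = standardLattice p r := by
      by_contra h
      exact hpS (hS.mem_toFinset.2 ⟨hp, h⟩)
    rw [h, map_natCast]
    exact smul_mem_of_norm_le_one (mem_standardLattice.2 hxi) (norm_natCast_le_one p _)

theorem exists_natCast_mul_den_eq_one
    (hΩ : ∀ (p : ℕ) [Fact p.Prime], Submodule.IsLattice ℚ_[p] (Ω p))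
    (hS : {p : ℕ | ∃ _ : Fact p.Prime, Ω p ≠ standardLattice p r}.Finite) :
    ∃ N : ℕ, N ≠ 0 ∧ ∀ x ∈ globalLattice Ω, ∀ i, ((N : ℚ) * x i).den = 1 := by
  have hk : ∀ p : ℕ, ∃ k : ℕ, ∀ _ : Fact p.Prime, ∀ x ∈ Ω p, ∀ i,
      ‖(p : ℚ_[p]) ^ k * x i‖ ≤ 1 := by
    intro p
    by_cases hp : p.Prime
    · have : Fact p.Prime := ⟨hp⟩
      obtain ⟨k, hk⟩ := exists_norm_pow_mul_coord_le_one (hΩ p)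
      exact ⟨k, fun _ => hk⟩
    · exact ⟨0, fun h => absurd h.out hp⟩
  choose k hk using hk
  have hprime : ∀ p ∈ hS.toFinset, p ≠ 0 := by
    intro p hp
    obtain ⟨h, _⟩ := hS.mem_toFinset.1 hp
    exact h.out.ne_zero
  refine ⟨∏ q ∈ hS.toFinset, q ^ k q,
    Finset.prod_ne_zero_iff.2 fun q hq => pow_ne_zero _ (hprime q hq), fun x hx i => ?_⟩
  refine den_eq_one_of_padic_norm_le_one fun p hp => ?_
  rw [Rat.cast_mul, Rat.cast_natCast]
  by_cases hpS : p ∈ hS.toFinset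
  · obtain ⟨a, ha, e⟩ := exists_natCast_prod_prime_pow_eq_mul (k := k) hpS
    rw [e, mul_assoc, norm_mul]
    exact mul_le_one₀ ha (norm_nonneg _) (hk p hp _ (hx p) i)
  · have h : Ω p = standardLattice p r := by
      by_contra h
      exact hpS (hS.mem_toFinset.2 ⟨hp, h⟩)
    have := hx p
    rw [h] at this
    rw [norm_mul]
    exact mul_le_one₀ (norm_natCast_le_one p _) (norm_nonneg _) (mem_standardLattice.1 this i)

theorem isLattice_globalLattice
    (hΩ : ∀ (p : ℕ) [Fact p.Prime], Submodule.IsLattice ℚ_[p] (Ω p))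
    (hS : {p : ℕ | ∃ _ : Fact p.Prime, Ω p ≠ standardLattice p r}.Finite) :
    Submodule.IsLattice ℚ (globalLattice Ω).toIntSubmodule where
  fg := by
    obtain ⟨N, hN, h⟩ := exists_natCast_mul_den_eq_one hΩ hS
    let f : (Fin r → ℤ) →ₗ[ℤ] (Fin r → ℚ) :=
      { toFun := fun z k => (N : ℚ)⁻¹ * z k
        map_add' := fun x y => by funext k; simp [mul_add]
        map_smul' := fun c x => by funext k; simp; ring }
    -- `Λ` lies in `N⁻¹ ℤ^r`, and submodules of a finitely generated `ℤ`-module are finitely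
    -- generated.
    refine Submodule.FG.of_le (T := LinearMap.range f) (Submodule.FG.of_finite) ?_
    intro x hx
    refine ⟨fun k => ((N : ℚ) * x k).num, ?_⟩
    funext k
    change (N : ℚ)⁻¹ * (((N : ℚ) * x k).num : ℚ) = x k
    rw [(Rat.den_eq_one_iff _).1 (h x hx k)]
    field_simp
  span_eq_top := by
    obtain ⟨N, hN, h⟩ := exists_natCast_smul_mem_globalLattice hΩ hS
    rw [eq_top_iff]
    intro x _
    rw [pi_eq_sum_univ' x]
    refine Submodule.sum_mem _ fun i _ => Submodule.smul_mem _ _ ?_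
    have hi : (N : ℚ) • (Pi.single i 1 : Fin r → ℚ) ∈ globalLattice Ω := h _ fun j => by
      rw [Pi.single_apply]
      split_ifs <;> rfl
    have := Submodule.smul_mem _ (N : ℚ)⁻¹ (Submodule.subset_span (R := ℚ) hi)
    rwa [inv_smul_smul₀ (Nat.cast_ne_zero.2 hN)] at this

end Global

/-! ### Equality of the images of `Λ` under the forms -/

theorem exists_mem_apply_eq_of_inSingleOrbit {K : Type*} [Field K] {r n : ℕ}
    {Ω : Set (Fin r → K)} {ℓ : Fin n → Module.Dual K (Fin r → K)} (h : InSingleOrbit Ω ℓ)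
    (i j : Fin n) {x : Fin r → K} (hx : x ∈ Ω) : ∃ w ∈ Ω, ℓ j w = ℓ i x := by
  obtain ⟨u, hu, e⟩ := h i j
  refine ⟨u x, ?_, ?_⟩
  · have hu' : u • Ω = Ω := hu
    rw [← hu']
    exact Set.smul_mem_smul_set hx
  · rw [e]
    change ℓ i (u.symm (u x)) = _
    rw [u.symm_apply_apply]

theorem denseRange_coordEmb_padic (p : ℕ) [Fact p.Prime] (r : ℕ) :
    DenseRange (coordEmb ℚ_[p] : (Fin r → ℚ) → Fin r → ℚ_[p]) :=
  DenseRange.piMap fun _ => Padic.denseRange_ratCast p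

/-- Approximate `w` by a rational vector `v` and move `v` along a rational `e` with `L e = 1` back
to the hyperplane `L = y`. The resulting difference from `w` is `p ^ k • P v`, which lies in `M`
once `P v` is integral; this is an open condition that holds at `w`. -/
theorem exists_rat_mem_apply_eq {p : ℕ} [Fact p.Prime] {r : ℕ}
    {M : Submodule ℤ_[p] (Fin r → ℚ_[p])} (hM : Submodule.IsLattice ℚ_[p] M)
    {L : Module.Dual ℚ (Fin r → ℚ)} (hL : L ≠ 0) {w : Fin r → ℚ_[p]} (hw : w ∈ M) {y : ℚ}
    (hy : formOver ℚ_[p] L w = algebraMap ℚ ℚ_[p] y) :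
    ∃ x : Fin r → ℚ, coordEmb ℚ_[p] x ∈ M ∧ L x = y := by
  obtain ⟨e, he⟩ : ∃ e, L e = 1 := LinearMap.surjective hL 1
  set ℓ := formOver ℚ_[p] L
  obtain ⟨k, hk⟩ := exists_pow_smul_integral_mem hM
  have hp0 : (p : ℚ_[p]) ^ k ≠ 0 := pow_ne_zero _ (by exact_mod_cast (Fact.out : p.Prime).ne_zero)
  have hcont : Continuous ℓ := LinearMap.continuous_of_finiteDimensional ℓ
  let P : (Fin r → ℚ_[p]) → Fin r → ℚ_[p] := fun v =>
    ((p : ℚ_[p]) ^ k)⁻¹ • ((v - w) - ℓ (v - w) • coordEmb ℚ_[p] e)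
  have hP : Continuous P := by fun_prop
  have hopen : IsOpen (P ⁻¹' Metric.ball 0 1) := Metric.isOpen_ball.preimage hP
  obtain ⟨v, hv⟩ := (denseRange_coordEmb_padic p r).exists_mem_open hopen ⟨w, by simp [P]⟩
  have hv' : ‖P (coordEmb ℚ_[p] v)‖ < 1 := by simpa using hv
  have hmem := hk _ fun i => (norm_le_pi_norm _ i).trans hv'.le
  rw [smul_inv_smul₀ hp0] at hmem
  refine ⟨v - (L v - y) • e, ?_, by simp [he]⟩
  have := M.add_mem hmem hw
  convert this using 1
  have h1 : ℓ (coordEmb ℚ_[p] v - w) = algebraMap ℚ ℚ_[p] (L v - y) := by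
    rw [map_sub, hy, formOver_coordEmb, map_sub]
  rw [h1, sub_eq_add_neg v, ← neg_smul, coordEmb_add, coordEmb_smul, map_neg, neg_smul]
  abel

section Global

variable {r n : ℕ} {L : Fin n → Module.Dual ℚ (Fin r → ℚ)}
  {Ω : ∀ (p : ℕ) [Fact p.Prime], Submodule ℤ_[p] (Fin r → ℚ_[p])}

/-- Some multiple `N * d` of `x` lies in `Λ`; let `m` be the prime-to-`p` part of `N * d`. Dropping
the power of `p` costs nothing at primes `q ≠ p`, where `p` is a unit, and at `p` itself `x` is
already in `Ω p`. -/
theorem exists_coprime_multiple_mem_globalLattice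
    (hΩ : ∀ (p : ℕ) [Fact p.Prime], Submodule.IsLattice ℚ_[p] (Ω p))
    (hS : {p : ℕ | ∃ _ : Fact p.Prime, Ω p ≠ standardLattice p r}.Finite)
    (p : ℕ) [hp : Fact p.Prime] {x : Fin r → ℚ} (hx : coordEmb ℚ_[p] x ∈ Ω p) :
    ∃ m : ℕ, ¬ p ∣ m ∧ (m : ℚ) • x ∈ globalLattice Ω := by
  obtain ⟨N, hN, hNx⟩ := exists_natCast_smul_mem_globalLattice hΩ hS
  have hd : ∃ d : ℕ, d ≠ 0 ∧ ∀ i, ((d : ℚ) * x i).den = 1 := by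
    refine ⟨∏ i, (x i).den, Finset.prod_ne_zero_iff.2 fun i _ => (x i).den_ne_zero, fun i => ?_⟩
    rw [← Finset.prod_erase_mul _ _ (Finset.mem_univ i), Nat.cast_mul, mul_assoc,
      mul_comm ((x i).den : ℚ), Rat.mul_den_eq_num]
    exact_mod_cast Rat.den_intCast
      (((∏ j ∈ Finset.univ.erase i, (x j).den : ℕ) : ℤ) * (x i).num)
  obtain ⟨d, hd0, hd⟩ := hd
  obtain ⟨a, m, hpm, e⟩ := Nat.exists_eq_pow_mul_and_not_dvd (mul_ne_zero hN hd0) p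
    hp.out.one_lt.ne'
  refine ⟨m, hpm, fun q hq => ?_⟩
  by_cases hqp : q = p
  · subst hqp
    rw [coordEmb_smul, map_natCast]
    exact smul_mem_of_norm_le_one hx (norm_natCast_le_one q m)
  · have h1 := hNx ((d : ℚ) • x) hd q
    have hpow : ‖((p : ℚ_[q]) ^ a)⁻¹‖ ≤ 1 := by
      have : ‖(p : ℚ_[q])‖ = 1 :=
        Padic.norm_natCast_eq_one_iff.2 ((Nat.coprime_primes hq.out hp.out).2 hqp)
      simp [this]
    have h2 := smul_mem_of_norm_le_one h1 hpow
    rw [smul_smul, ← Nat.cast_mul, e, Nat.cast_mul, Nat.cast_pow, mul_smul, coordEmb_smul,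
      map_pow, map_natCast, inv_smul_smul₀] at h2
    · exact h2
    · exact pow_ne_zero _ (by exact_mod_cast hp.out.ne_zero)

/-- The integers `c` for which `c • L i x` lies in the image of `L j` form an ideal. By the orbit
condition at `p` it contains an element prime to `p`, for every `p`, so it is all of `ℤ`. -/
theorem map_globalLattice_le
    (hΩ : ∀ (p : ℕ) [Fact p.Prime], Submodule.IsLattice ℚ_[p] (Ω p))
    (hS : {p : ℕ | ∃ _ : Fact p.Prime, Ω p ≠ standardLattice p r}.Finite)
    (horb : ∀ (p : ℕ) [Fact p.Prime],
      InSingleOrbit (Ω p : Set (Fin r → ℚ_[p])) fun i => formOver ℚ_[p] (L i))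
    (i j : Fin n) (hj : L j ≠ 0) :
    (globalLattice Ω).toIntSubmodule.map ((L i).restrictScalars ℤ) ≤
      (globalLattice Ω).toIntSubmodule.map ((L j).restrictScalars ℤ) := by
  rintro _ ⟨x, hx, rfl⟩
  set A := (globalLattice Ω).toIntSubmodule.map ((L j).restrictScalars ℤ)
  change L i x ∈ A
  set I : Ideal ℤ := A.comap (LinearMap.toSpanSingleton ℤ ℚ (L i x))
  have hI : ∀ p : ℕ, p.Prime → ∃ m : ℕ, ¬ p ∣ m ∧ (m : ℤ) ∈ I := by
    intro p hp
    have : Fact p.Prime := ⟨hp⟩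
    obtain ⟨w, hw, e⟩ := exists_mem_apply_eq_of_inSingleOrbit (horb p) i j
      (x := coordEmb ℚ_[p] x) (hx p)
    rw [formOver_coordEmb] at e
    obtain ⟨x', hx', e'⟩ := exists_rat_mem_apply_eq (hΩ p) hj hw e
    obtain ⟨m, hm, hmx⟩ := exists_coprime_multiple_mem_globalLattice hΩ hS p hx'
    refine ⟨m, hm, ⟨(m : ℚ) • x', hmx, ?_⟩⟩
    simp [e']
  have hg : (Submodule.IsPrincipal.generator I).natAbs = 1 := by
    by_contra h
    obtain ⟨p, hp, hpg⟩ := Nat.exists_prime_and_dvd h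
    obtain ⟨m, hm, hmI⟩ := hI p hp
    refine hm (hpg.trans ?_)
    have := (Submodule.IsPrincipal.mem_iff_generator_dvd I).1 hmI
    exact Int.natAbs_dvd_natAbs.2 this
  have h1 : (1 : ℤ) ∈ I := by
    rw [Submodule.IsPrincipal.mem_iff_generator_dvd I]
    exact (Int.isUnit_iff_natAbs_eq.2 hg).dvd
  have h2 : (1 : ℤ) • L i x ∈ A := h1
  rwa [one_smul] at h2

end Global

/-! ### Adapted bases, covolume and a lower bound for lattice points -/

theorem exists_span_singleton_eq_map {r : ℕ} {Λ : Submodule ℤ (Fin r → ℚ)}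
    (hΛ : Submodule.IsLattice ℚ Λ) {L : Module.Dual ℚ (Fin r → ℚ)} (hL : L ≠ 0) :
    ∃ g : ℚ, g ≠ 0 ∧ Λ.map (L.restrictScalars ℤ) = Submodule.span ℤ {g} := by
  set A := Λ.map (L.restrictScalars ℤ)
  have hA : Submodule.IsLattice ℚ A := by
    refine ⟨hΛ.fg.map _, ?_⟩
    have : Submodule.span ℚ (A : Set ℚ) = (Submodule.span ℚ (Λ : Set (Fin r → ℚ))).map L := by
      rw [Submodule.map_span]
      rfl
    rw [this, hΛ.span_eq_top, Submodule.map_top, LinearMap.range_eq_top]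
    exact LinearMap.surjective hL
  have hfr : Module.finrank ℤ A = 1 := by
    refine Module.finrank_eq_of_rank_eq ?_
    rw [Submodule.IsLattice.rank' ℚ A]
    simp
  have : Module.Free ℤ A := Submodule.IsLattice.free ℚ A
  let b := Module.finBasisOfFinrankEq ℤ A hfr
  have hspan : Submodule.span ℤ {(b 0 : ℚ)} = A := by
    have h := congrArg (Submodule.map A.subtype) b.span_eq
    rw [Submodule.map_span, Submodule.map_top, Submodule.range_subtype, Set.range_unique,
      Set.image_singleton] at h
    exact h
  exact ⟨b 0, fun h => b.ne_zero 0 (Subtype.ext h), hspan.symm⟩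

theorem exists_adapted_basis {m : ℕ} {Λ : Submodule ℤ (Fin (m + 1) → ℚ)}
    (hΛ : Submodule.IsLattice ℚ Λ) {L : Module.Dual ℚ (Fin (m + 1) → ℚ)} {g : ℚ} (hg : g ≠ 0)
    (h : Λ.map (L.restrictScalars ℤ) = Submodule.span ℤ {g}) :
    ∃ b : Module.Basis (Fin (m + 1)) ℤ Λ, L (b 0) = g ∧ ∀ k : Fin m, L (b k.succ) = 0 := by
  have : Module.Free ℤ Λ := Submodule.IsLattice.free ℚ Λ
  have : Module.Finite ℤ Λ := Submodule.IsLattice.finite ℚ Λ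
  let f : Λ →ₗ[ℤ] ℚ := (L.restrictScalars ℤ).comp Λ.subtype
  set N := LinearMap.ker f
  obtain ⟨e, he, heg⟩ : g ∈ Λ.map (L.restrictScalars ℤ) := by
    rw [h]
    exact Submodule.mem_span_singleton_self g
  have hli : ∀ (c : ℤ), ∀ x ∈ N, c • (⟨e, he⟩ : Λ) + x = 0 → c = 0 := by
    intro c x hx hcx
    have h0 := congrArg f hcx
    rw [map_add, map_smul, LinearMap.mem_ker.1 hx, add_zero, map_zero] at h0
    have : f ⟨e, he⟩ = g := heg
    rw [this] at h0
    exact (smul_eq_zero.1 h0).resolve_right hg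
  have hsp : ∀ z : Λ, ∃ c : ℤ, z + c • (⟨e, he⟩ : Λ) ∈ N := by
    intro z
    have hz : f z ∈ Submodule.span ℤ {g} := h ▸ ⟨z, z.2, rfl⟩
    obtain ⟨c, hc⟩ := Submodule.mem_span_singleton.1 hz
    refine ⟨-c, LinearMap.mem_ker.2 ?_⟩
    have : f ⟨e, he⟩ = g := heg
    rw [map_add, map_smul, this, ← hc]
    simp
  -- This first basis only serves to show that the kernel has rank `m`, so that the final one can be
  -- indexed by `Fin (m + 1)`.
  let b := Module.Basis.mkFinCons (⟨e, he⟩ : Λ) (Module.finBasis ℤ N) hli hsp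
  have hrank : Module.finrank ℤ N + 1 = m + 1 := by
    have h1 := Module.finrank_eq_card_basis b
    have h2 := Submodule.IsLattice.finrank_of_pi ℚ Λ
    simp only [Fintype.card_fin] at h1 h2
    omega
  have hm : Module.finrank ℤ N = m := by omega
  let b' := Module.Basis.mkFinCons (⟨e, he⟩ : Λ) (Module.finBasisOfFinrankEq ℤ N hm) hli hsp
  refine ⟨b', ?_, fun k => ?_⟩
  · simp only [b', Module.Basis.coe_mkFinCons, Fin.cons_zero]
    exact heg
  · simp only [b', Module.Basis.coe_mkFinCons, Fin.cons_succ]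
    exact LinearMap.mem_ker.1 (Module.finBasisOfFinrankEq ℤ N hm k).2

/-- The real matrix whose columns are the members of a `ℤ`-basis of a lattice in `ℚ^r`. -/
noncomputable def latticeMatrix {r : ℕ} {Λ : Submodule ℤ (Fin r → ℚ)}
    (b : Module.Basis (Fin r) ℤ Λ) : Matrix (Fin r) (Fin r) ℝ :=
  Matrix.of fun i k => ((b k : Fin r → ℚ) i : ℝ)

section Matrix

variable {r : ℕ} {Λ : Submodule ℤ (Fin r → ℚ)}

theorem det_latticeMatrix_ne_zero (hΛ : Submodule.IsLattice ℚ Λ) (b : Module.Basis (Fin r) ℤ Λ) :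
    (latticeMatrix b).det ≠ 0 := by
  set A : Matrix (Fin r) (Fin r) ℚ := Matrix.of fun i k => (b k : Fin r → ℚ) i
  have e : latticeMatrix b = A.map (Rat.castHom ℝ) := rfl
  have hA : IsUnit A := by
    rw [← Matrix.linearIndependent_cols_iff_isUnit]
    have := (b.extendOfIsLattice ℚ).linearIndependent
    have hcol : A.col = b.extendOfIsLattice ℚ := by
      funext k
      rw [Module.Basis.extendOfIsLattice_apply]
      rfl
    rwa [hcol]
  have hdet := ((Matrix.isUnit_iff_isUnit_det _).1 hA).ne_zero
  rw [e, ← RingHom.mapMatrix_apply, ← RingHom.map_det]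
  exact (map_ne_zero _).2 hdet

/-- Two bases differ by an integer matrix of determinant `±1`. -/
theorem abs_det_latticeMatrix_eq (b b' : Module.Basis (Fin r) ℤ Λ) :
    |(latticeMatrix b').det| = |(latticeMatrix b).det| := by
  set U : Matrix (Fin r) (Fin r) ℤ := b.toMatrix b'
  have hU : IsUnit U.det := by
    have h := congrArg Matrix.det (b.toMatrix_mul_toMatrix_flip b')
    rw [Matrix.det_mul, Matrix.det_one] at h
    exact IsUnit.of_mul_eq_one _ h
  have e : latticeMatrix b' = latticeMatrix b * U.map (Int.castRingHom ℝ) := by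
    ext i k
    have h := congrArg (fun x : Λ => (x : Fin r → ℚ) i) (b.sum_toMatrix_smul_self b' k)
    simp only [Submodule.coe_sum, Finset.sum_apply, Submodule.coe_smul] at h
    simp only [latticeMatrix, Matrix.mul_apply, Matrix.of_apply, Matrix.map_apply, U, ← h]
    rw [Rat.cast_sum]
    refine Finset.sum_congr rfl fun l _ => ?_
    rw [Pi.smul_apply, zsmul_eq_mul]
    push_cast
    exact mul_comm _ _
  rw [e, Matrix.det_mul, abs_mul, ← RingHom.mapMatrix_apply, ← RingHom.map_det]
  rcases Int.isUnit_iff.1 hU with h | h <;> simp [h]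

theorem latticeMatrix_mulVec_intCast (b : Module.Basis (Fin r) ℤ Λ) (z : Fin r → ℤ) :
    (latticeMatrix b).mulVec (fun k => (z k : ℝ)) = coordEmb ℝ (b.equivFun.symm z : Fin r → ℚ) := by
  funext i
  simp [latticeMatrix, Matrix.mulVec, dotProduct, coordEmb, Module.Basis.equivFun_symm_apply,
    Finset.sum_apply, mul_comm]

theorem exists_norm_le_mul_norm_mulVec {M : Matrix (Fin r) (Fin r) ℝ} (hM : M.det ≠ 0) :
    ∃ c : ℝ, 0 < c ∧ ∀ v, ‖v‖ ≤ c * ‖M.mulVec v‖ := by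
  let f := (Matrix.mulVecLin M⁻¹).toContinuousLinearMap
  refine ⟨‖f‖ + 1, by positivity, fun v => ?_⟩
  have e : f (M.mulVec v) = v := by
    change M⁻¹.mulVec (M.mulVec v) = v
    rw [Matrix.mulVec_mulVec, Matrix.nonsing_inv_mul _ hM.isUnit, Matrix.one_mulVec]
  have := f.le_opNorm (M.mulVec v)
  rw [e] at this
  nlinarith [norm_nonneg (M.mulVec v)]

theorem exists_norm_mulVec_le (M : Matrix (Fin r) (Fin r) ℝ) :
    ∃ c : ℝ, 0 < c ∧ ∀ v, ‖M.mulVec v‖ ≤ c * ‖v‖ := by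
  let f := (Matrix.mulVecLin M).toContinuousLinearMap
  refine ⟨‖f‖ + 1, by positivity, fun v => ?_⟩
  have := f.le_opNorm v
  have e : f v = M.mulVec v := rfl
  rw [e] at this
  nlinarith [norm_nonneg v]

theorem measurable_mulVec (M : Matrix (Fin r) (Fin r) ℝ) : Measurable M.mulVec :=
  (Matrix.mulVecLin M).toContinuousLinearMap.continuous.measurable

theorem lattice_inter_eq_image (b : Module.Basis (Fin r) ℤ Λ) (W : Set (Fin r → ℝ)) :
    {x | x ∈ Λ ∧ coordEmb ℝ x ∈ W} =
      (fun z => (b.equivFun.symm z : Fin r → ℚ)) ''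
        intPoints ((latticeMatrix b).mulVec ⁻¹' W) := by
  ext x
  constructor
  · rintro ⟨hx, hW⟩
    refine ⟨b.equivFun ⟨x, hx⟩, ?_, by simp⟩
    change (latticeMatrix b).mulVec _ ∈ W
    rw [latticeMatrix_mulVec_intCast]
    simpa using hW
  · rintro ⟨z, hz, rfl⟩
    refine ⟨(b.equivFun.symm z).2, ?_⟩
    rw [← latticeMatrix_mulVec_intCast]
    exact hz

theorem equivFun_symm_injective (b : Module.Basis (Fin r) ℤ Λ) :
    Function.Injective fun z => (b.equivFun.symm z : Fin r → ℚ) :=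
  Subtype.val_injective.comp b.equivFun.symm.injective

theorem mulVec_preimage_bound {M : Matrix (Fin r) (Fin r) ℝ} {c R : ℝ} (hc : 0 ≤ c)
    (hM : ∀ v, ‖v‖ ≤ c * ‖M.mulVec v‖) {W : Set (Fin r → ℝ)} (hW : ∀ x ∈ W, ‖x‖ ≤ R) :
    ∀ v ∈ M.mulVec ⁻¹' W, ∀ k, |v k| ≤ c * R := fun v hv k =>
  (norm_le_pi_norm v k).trans ((hM v).trans (mul_le_mul_of_nonneg_left (hW _ hv) hc))

theorem lattice_inter_finite (hΛ : Submodule.IsLattice ℚ Λ) (b : Module.Basis (Fin r) ℤ Λ)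
    {W : Set (Fin r → ℝ)} {R : ℝ} (hW : ∀ x ∈ W, ‖x‖ ≤ R) :
    {x | x ∈ Λ ∧ coordEmb ℝ x ∈ W}.Finite := by
  obtain ⟨c, hc, h⟩ := exists_norm_le_mul_norm_mulVec (det_latticeMatrix_ne_zero hΛ b)
  rw [lattice_inter_eq_image b]
  exact (intPoints_finite (mulVec_preimage_bound hc.le h hW)).image _

theorem exists_mul_pow_le_ncard_lattice_inter (hΛ : Submodule.IsLattice ℚ Λ)
    (b : Module.Basis (Fin r) ℤ Λ) : ∃ c : ℝ, 0 < c ∧ ∀ (W : Set (Fin r → ℝ)) (R ε : ℝ), 0 < ε →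
      (∀ x ∈ W, ‖x‖ ≤ R) → (∀ x, ‖x‖ < ε → x ∈ W) →
      (c * ε) ^ r ≤ ({x | x ∈ Λ ∧ coordEmb ℝ x ∈ W}.ncard : ℝ) := by
  obtain ⟨c, hc, h⟩ := exists_norm_mulVec_le (latticeMatrix b)
  refine ⟨(2 * c)⁻¹, by positivity, fun W R ε hε hR hW => ?_⟩
  have hfin := lattice_inter_finite hΛ b hR
  rw [lattice_inter_eq_image b] at hfin ⊢
  have hfin' := Set.Finite.of_finite_image hfin (equivFun_symm_injective b).injOn
  rw [Set.ncard_image_of_injective _ (equivFun_symm_injective b)]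
  -- Integer vectors of norm at most `s` land within `ε / 2`, strictly inside the ball contained in
  -- `W`. There are `(2 * ⌊s⌋₊ + 1) ^ r` of them, at least `s ^ r` however small `s` is.
  set s := (2 * c)⁻¹ * ε
  have hs : 0 < s := by positivity
  set T : Finset (Fin r → ℤ) := Fintype.piFinset fun _ => Finset.Icc (-(⌊s⌋₊ : ℤ)) ⌊s⌋₊
  have hT : (T : Set (Fin r → ℤ)) ⊆ intPoints ((latticeMatrix b).mulVec ⁻¹' W) := by
    intro z hz
    refine hW _ ((h _).trans_lt ?_)
    have hz' : ‖fun k => (z k : ℝ)‖ ≤ s := by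
      refine (pi_norm_le_iff_of_nonneg hs.le).2 fun k => ?_
      have hk := Finset.mem_Icc.1 (Fintype.mem_piFinset.1 (Finset.mem_coe.1 hz) k)
      have hk' : |z k| ≤ (⌊s⌋₊ : ℤ) := abs_le.2 hk
      rw [Real.norm_eq_abs]
      have : ((|z k| : ℤ) : ℝ) ≤ ((⌊s⌋₊ : ℤ) : ℝ) := by exact_mod_cast hk'
      push_cast at this
      exact this.trans (Nat.floor_le hs.le)
    refine (mul_le_mul_of_nonneg_left hz' hc.le).trans_lt ?_
    have : c * s = ε / 2 := by
      simp only [s]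
      field_simp
    linarith
  have hcard : T.card = (2 * ⌊s⌋₊ + 1) ^ r := by
    simp only [T, Fintype.card_piFinset, Int.card_Icc, Finset.prod_const, Finset.card_univ,
      Fintype.card_fin]
    congr 1
    omega
  have h1 := Set.ncard_le_ncard hT hfin'
  rw [Set.ncard_coe_finset, hcard] at h1
  have h2 : s ^ r ≤ (2 * (⌊s⌋₊ : ℝ) + 1) ^ r := by
    refine pow_le_pow_left₀ hs.le ?_ _
    have := Nat.lt_floor_add_one s
    have : (0 : ℝ) ≤ ⌊s⌋₊ := Nat.cast_nonneg _
    linarith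
  exact h2.trans (by exact_mod_cast h1)

end Matrix

/-! ### Slices of the lattice and their volumes -/

section Slice

variable {m : ℕ}

theorem apply_equivFun_symm {Λ : Submodule ℤ (Fin (m + 1) → ℚ)}
    {L : Module.Dual ℚ (Fin (m + 1) → ℚ)} {g : ℚ} {b : Module.Basis (Fin (m + 1)) ℤ Λ}
    (hb0 : L (b 0) = g) (hb : ∀ k : Fin m, L (b k.succ) = 0) (z : Fin (m + 1) → ℤ) :
    L (b.equivFun.symm z : Fin (m + 1) → ℚ) = z 0 • g := by
  have e : (b.equivFun.symm z : Fin (m + 1) → ℚ) = ∑ k, z k • (b k : Fin (m + 1) → ℚ) := by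
    rw [Module.Basis.equivFun_symm_apply]
    simp
  rw [e, map_sum, Fin.sum_univ_succ, map_zsmul, hb0]
  simp only [map_zsmul, hb, smul_zero, Finset.sum_const_zero, add_zero]

theorem formOver_latticeMatrix_mulVec {Λ : Submodule ℤ (Fin (m + 1) → ℚ)}
    {L : Module.Dual ℚ (Fin (m + 1) → ℚ)} {g : ℚ} {b : Module.Basis (Fin (m + 1)) ℤ Λ}
    (hb0 : L (b 0) = g) (hb : ∀ k : Fin m, L (b k.succ) = 0) (v : Fin (m + 1) → ℝ) :
    formOver ℝ L ((latticeMatrix b).mulVec v) = v 0 * g := by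
  have e : (latticeMatrix b).mulVec v =
      ∑ k, v k • coordEmb ℝ (b k : Fin (m + 1) → ℚ) := by
    funext i
    simp [latticeMatrix, Matrix.mulVec, dotProduct, coordEmb, mul_comm]
  rw [e, map_sum, Fin.sum_univ_succ]
  simp [formOver_coordEmb, hb0, hb]

theorem ncard_lattice_slice {Λ : Submodule ℤ (Fin (m + 1) → ℚ)}
    {L : Module.Dual ℚ (Fin (m + 1) → ℚ)} {g : ℚ} (hg : g ≠ 0)
    {b : Module.Basis (Fin (m + 1)) ℤ Λ}
    (hb0 : L (b 0) = g) (hb : ∀ k : Fin m, L (b k.succ) = 0) (W : Set (Fin (m + 1) → ℝ))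
    (t : ℤ) :
    {x | (x ∈ Λ ∧ coordEmb ℝ x ∈ W) ∧ L x = t • g}.ncard =
      (intPoints (headSlice ((latticeMatrix b).mulVec ⁻¹' W) t)).ncard := by
  have hinj : Function.Injective fun z : Fin m → ℤ =>
      (b.equivFun.symm (Fin.cons t z) : Fin (m + 1) → ℚ) := fun z w h =>
    (Fin.cons_inj.1 (equivFun_symm_injective b h)).2
  have e : ∀ z : Fin m → ℤ, (fun k => ((Fin.cons t z : Fin (m + 1) → ℤ) k : ℝ)) =
      Fin.cons (t : ℝ) fun k => (z k : ℝ) := by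
    intro z
    funext k
    refine Fin.cases ?_ (fun k => ?_) k <;> simp
  rw [← Set.ncard_image_of_injective _ hinj]
  congr 1
  ext x
  constructor
  · rintro ⟨hx, hL⟩
    have hx' : x ∈ {x | x ∈ Λ ∧ coordEmb ℝ x ∈ W} := hx
    rw [lattice_inter_eq_image b] at hx'
    obtain ⟨z, hz, rfl⟩ := hx'
    rw [apply_equivFun_symm hb0 hb] at hL
    have ht : z 0 = t := by
      have := sub_eq_zero.2 hL
      rw [← sub_smul] at this
      exact sub_eq_zero.1 ((smul_eq_zero.1 this).resolve_right hg)
    subst ht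
    refine ⟨Fin.tail z, ?_, ?_⟩
    · change Fin.cons _ _ ∈ (latticeMatrix b).mulVec ⁻¹' W
      rw [← e, Fin.cons_self_tail]
      exact hz
    · simp only [Fin.cons_self_tail]
  · rintro ⟨z, hz, rfl⟩
    refine ⟨?_, by rw [apply_equivFun_symm hb0 hb]; simp⟩
    change _ ∈ {x | x ∈ Λ ∧ coordEmb ℝ x ∈ W}
    rw [lattice_inter_eq_image b]
    refine ⟨_, ?_, rfl⟩
    change (fun k => ((Fin.cons t z : Fin (m + 1) → ℤ) k : ℝ)) ∈ (latticeMatrix b).mulVec ⁻¹' W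
    rw [e]
    exact hz

theorem mulVec_finCons {S : Matrix (Fin (m + 1)) (Fin (m + 1)) ℝ}
    (hS : ∀ v, S.mulVec v 0 = v 0) (t : ℝ) (x : Fin m → ℝ) :
    S.mulVec (Fin.cons t x) =
      Fin.cons t ((S.submatrix Fin.succ Fin.succ).mulVec x + fun k => S k.succ 0 * t) := by
  funext k
  refine Fin.cases ?_ (fun k => ?_) k
  · simpa using hS (Fin.cons t x)
  · simp [Matrix.mulVec, dotProduct, Fin.sum_univ_succ, add_comm]

theorem det_submatrix_succ {S : Matrix (Fin (m + 1)) (Fin (m + 1)) ℝ}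
    (hS : ∀ v, S.mulVec v 0 = v 0) : (S.submatrix Fin.succ Fin.succ).det = S.det := by
  have h0 : ∀ k, S 0 k = if k = 0 then 1 else 0 := by
    intro k
    have := hS (Pi.single k 1)
    rw [Matrix.mulVec_single_one] at this
    simpa [Pi.single_apply, eq_comm] using this
  rw [Matrix.det_succ_row_zero S, Fin.sum_univ_succ]
  simp [h0, Fin.succ_ne_zero]

theorem volume_preimage_mulVec_add {A : Matrix (Fin m) (Fin m) ℝ} (hA : |A.det| = 1)
    (c : Fin m → ℝ) (K : Set (Fin m → ℝ)) :
    volume.real ((fun x => A.mulVec x + c) ⁻¹' K) = volume.real K := by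
  have hdet : LinearMap.det (Matrix.toLin' A) = A.det := LinearMap.det_toLin' A
  have h0 : LinearMap.det (Matrix.toLin' A) ≠ 0 := by
    rw [hdet]
    intro h
    simp [h] at hA
  have e : (fun x => A.mulVec x + c) ⁻¹' K = Matrix.toLin' A ⁻¹' ((fun x => x + c) ⁻¹' K) := rfl
  rw [e, Measure.real, Measure.addHaar_preimage_linearMap _ h0, hdet, abs_inv, hA,
    measure_preimage_add_right]
  simp [Measure.real]

/-- The matrix `S = M'⁻¹ U M` carries the first body to the second and fixes the first coordinate,
because both forms read it off up to the factor `g`. On each slice it is therefore an affine map,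
whose linear part has determinant `det S = ±1`. -/
theorem volume_headSlice_eq {M M' U : Matrix (Fin (m + 1)) (Fin (m + 1)) ℝ} (hM' : M'.det ≠ 0)
    (hdet : |U.det * M.det| = |M'.det|) {W : Set (Fin (m + 1) → ℝ)}
    (hU : U.mulVec ⁻¹' W = W) {ℓ ℓ' : Module.Dual ℝ (Fin (m + 1) → ℝ)}
    (hℓ : ∀ v, ℓ' (U.mulVec v) = ℓ v) {g : ℝ} (hg : g ≠ 0) (h : ∀ v, ℓ (M.mulVec v) = v 0 * g)
    (h' : ∀ v, ℓ' (M'.mulVec v) = v 0 * g) (t : ℝ) :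
    volume.real (headSlice (M.mulVec ⁻¹' W) t) = volume.real (headSlice (M'.mulVec ⁻¹' W) t) := by
  set S := M'⁻¹ * (U * M)
  have hS : M' * S = U * M := Matrix.mul_nonsing_inv_cancel_left _ _ hM'.isUnit
  have hSdet : |S.det| = 1 := by
    have := congrArg (fun X => |Matrix.det X|) hS
    simp only [Matrix.det_mul, abs_mul] at this hdet
    rw [hdet] at this
    exact mul_left_cancel₀ (abs_ne_zero.2 hM') (this.trans (mul_one _).symm)
  have hSv : ∀ v, M'.mulVec (S.mulVec v) = U.mulVec (M.mulVec v) := by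
    intro v
    rw [Matrix.mulVec_mulVec, Matrix.mulVec_mulVec, hS]
  have hS0 : ∀ v, S.mulVec v 0 = v 0 := by
    intro v
    have := h' (S.mulVec v)
    rw [hSv, hℓ, h] at this
    exact (mul_right_cancel₀ hg this).symm
  rw [← volume_preimage_mulVec_add (A := S.submatrix Fin.succ Fin.succ)
    (by rw [det_submatrix_succ hS0, hSdet]) (fun k => S k.succ 0 * t)
    (headSlice (M'.mulVec ⁻¹' W) t)]
  congr 1
  ext x
  change M.mulVec (Fin.cons t x) ∈ W ↔ M'.mulVec (Fin.cons t _) ∈ W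
  rw [← mulVec_finCons hS0, hSv]
  nth_rw 1 [← hU]
  rfl

end Slice

/-! ### Ellipsoids as convex bodies -/

section Ellipsoid

variable {r : ℕ} {Q : QuadraticForm ℝ (Fin r → ℝ)}

theorem continuous_quadraticForm (Q : QuadraticForm ℝ (Fin r → ℝ)) : Continuous Q := by
  set B := QuadraticMap.associated (R := ℝ) Q
  have e : ∀ x, Q x = ∑ i, x i * B.flip (Pi.single i 1) x := by
    intro x
    rw [← QuadraticMap.associated_eq_self_apply ℝ Q x]
    have h : B x x = B x (∑ i, x i • Pi.single i 1) := by rw [← pi_eq_sum_univ' x]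
    rw [h, map_sum]
    simp
  rw [funext e]
  exact continuous_finsetSum _ fun i _ => (continuous_apply i).mul
    (LinearMap.continuous_of_finiteDimensional _)

theorem exists_mul_norm_sq_le (hQ : Q.PosDef) : ∃ c : ℝ, 0 < c ∧ ∀ x, c * ‖x‖ ^ 2 ≤ Q x := by
  obtain ⟨c, hc, h⟩ : ∃ c : ℝ, 0 < c ∧ ∀ x ∈ Metric.sphere (0 : Fin r → ℝ) 1, c ≤ Q x := by
    rcases (Metric.sphere (0 : Fin r → ℝ) 1).eq_empty_or_nonempty with he | hne
    · exact ⟨1, one_pos, fun x hx => by simp [he] at hx⟩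
    · obtain ⟨x₀, hx₀, hmin⟩ := (isCompact_sphere (0 : Fin r → ℝ) 1).exists_isMinOn hne
        (continuous_quadraticForm Q).continuousOn
      refine ⟨Q x₀, hQ x₀ ?_, fun x hx => hmin hx⟩
      rintro rfl
      simp at hx₀
  refine ⟨c, hc, fun x => ?_⟩
  by_cases hx : x = 0
  · simp [hx]
  · have hn : ‖x‖ ≠ 0 := norm_ne_zero_iff.2 hx
    have h1 := h (‖x‖⁻¹ • x) (by simp [norm_smul, hn])
    rw [QuadraticMap.map_smul, smul_eq_mul] at h1
    calc c * ‖x‖ ^ 2 ≤ ‖x‖⁻¹ * ‖x‖⁻¹ * Q x * ‖x‖ ^ 2 := by gcongr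
      _ = Q x := by field_simp

theorem quadraticForm_convex_combination_le (hQ : Q.PosDef) (x y : Fin r → ℝ) {a b : ℝ}
    (ha : 0 ≤ a) (hb : 0 ≤ b) (hab : a + b = 1) : Q (a • x + b • y) ≤ a * Q x + b * Q y := by
  have h1 : Q (a • x + b • y) = a * a * Q x + b * b * Q y + a * b * QuadraticMap.polar Q x y := by
    rw [QuadraticMap.map_add Q, QuadraticMap.map_smul, QuadraticMap.map_smul,
      QuadraticMap.polar_smul_left, QuadraticMap.polar_smul_right]
    simp only [smul_eq_mul]
    ring
  have h2 : Q (x - y) = Q x + Q y - QuadraticMap.polar Q x y := by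
    rw [sub_eq_add_neg, QuadraticMap.map_add Q, QuadraticMap.map_neg, QuadraticMap.polar_neg_right]
    ring
  -- The two sides differ by exactly `a * b * Q (x - y)`.
  have h3 : 0 ≤ a * b * Q (x - y) := mul_nonneg (mul_nonneg ha hb) (hQ.nonneg _)
  rw [h2] at h3
  rw [h1]
  have hb' : b = 1 - a := by linarith
  subst hb'
  nlinarith

/-- The properties of a solid ellipsoid on which the lattice point count depends. -/
structure IsConvexBodyAtZero (W : Set (Fin r → ℝ)) (ε R : ℝ) : Prop where
  convex : Convex ℝ W
  measurableSet : MeasurableSet W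
  eps_pos : 0 < ε
  ball_subset : ∀ x, ‖x‖ < ε → x ∈ W
  norm_le : ∀ x ∈ W, ‖x‖ ≤ R

theorem IsEllipsoidOf.exists_isConvexBodyAtZero (hQ : Q.PosDef) {W : Set (Fin r → ℝ)}
    (hW : IsEllipsoidOf Q W) : ∃ ε R, 0 ≤ R ∧ IsConvexBodyAtZero W ε R := by
  have hcont := continuous_quadraticForm Q
  have hsub : W ⊆ {x | Q x ≤ 1} := by
    rcases hW with rfl | rfl
    · exact subset_rfl
    · exact fun x (hx : Q x < 1) => (hx.le : Q x ≤ 1)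
  have hsup : {x | Q x < 1} ⊆ W := by
    rcases hW with rfl | rfl
    · exact fun x (hx : Q x < 1) => (hx.le : Q x ≤ 1)
    · exact subset_rfl
  obtain ⟨c, hc, hcQ⟩ := exists_mul_norm_sq_le hQ
  obtain ⟨ε, hε, hball⟩ := Metric.isOpen_iff.1 (isOpen_lt hcont continuous_const)
    (0 : Fin r → ℝ) (show Q 0 < 1 by simp)
  refine ⟨ε, c⁻¹ + 1, by positivity, ?_, ?_, hε, fun x hx => hsup (hball (by simpa using hx)),
    fun x hx => ?_⟩
  · have hcomb : ∀ x y : Fin r → ℝ, ∀ a b : ℝ, 0 ≤ a → 0 ≤ b → a + b = 1 →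
        Q (a • x + b • y) ≤ a * Q x + b * Q y := fun x y a b ha hb hab =>
      quadraticForm_convex_combination_le hQ x y ha hb hab
    have hconv : ConvexOn ℝ Set.univ Q := ⟨convex_univ, fun x _ y _ a b ha hb hab =>
      hcomb x y a b ha hb hab⟩
    rcases hW with rfl | rfl
    · simpa using hconv.convex_le 1
    · simpa using hconv.convex_lt 1
  · rcases hW with rfl | rfl
    · exact (isClosed_le hcont continuous_const).measurableSet
    · exact (isOpen_lt hcont continuous_const).measurableSet
  · have h1 : Q x ≤ 1 := hsub hx
    have h2 : ‖x‖ ^ 2 ≤ c⁻¹ := by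
      rw [← one_div, le_div_iff₀ hc, mul_comm]
      exact (hcQ x).trans h1
    nlinarith [sq_nonneg (‖x‖ - 1)]

theorem IsConvexBodyAtZero.smul {W : Set (Fin r → ℝ)} {ε R : ℝ} (hW : IsConvexBodyAtZero W ε R)
    {D : ℝ} (hD : 0 < D) : IsConvexBodyAtZero (D • W) (D * ε) (D * R) where
  convex := hW.convex.smul D
  measurableSet := hW.measurableSet.const_smul₀ D
  eps_pos := mul_pos hD hW.eps_pos
  ball_subset x hx := by
    rw [Set.mem_smul_set_iff_inv_smul_mem₀ hD.ne']
    refine hW.ball_subset _ ?_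
    rw [norm_smul, norm_inv, Real.norm_of_nonneg hD.le, ← div_eq_inv_mul, div_lt_iff₀ hD, mul_comm]
    exact hx
  norm_le := by
    rintro _ ⟨x, hx, rfl⟩
    change ‖D • x‖ ≤ _
    rw [norm_smul, Real.norm_of_nonneg hD.le]
    exact mul_le_mul_of_nonneg_left (hW.norm_le x hx) hD.le

/-- The map `u` sends `W` onto itself, and `W` has finite nonzero volume. -/
theorem abs_det_eq_one_of_mem_unitaryGroup {W : Set (Fin r → ℝ)} {ε R : ℝ}
    (hW : IsConvexBodyAtZero W ε R) {u : (Fin r → ℝ) ≃ₗ[ℝ] (Fin r → ℝ)}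
    (hu : u ∈ unitaryGroup W) : |(LinearMap.toMatrix' (u : (Fin r → ℝ) →ₗ[ℝ] _)).det| = 1 := by
  have hu' : u • W = W := hu
  have h0 : volume W ≠ 0 := by
    have h : Metric.ball (0 : Fin r → ℝ) ε ⊆ W := fun x hx => hW.ball_subset x (by simpa using hx)
    exact ((Metric.measure_ball_pos volume _ hW.eps_pos).trans_le (measure_mono h)).ne'
  have htop : volume W ≠ ⊤ := by
    have h : W ⊆ Metric.closedBall 0 R := fun x hx => by simpa using hW.norm_le x hx
    exact (measure_mono h |>.trans_lt (measure_closedBall_lt_top)).ne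
  have h := Measure.addHaar_image_linearMap volume (u : (Fin r → ℝ) →ₗ[ℝ] (Fin r → ℝ)) W
  have himg : (u : (Fin r → ℝ) →ₗ[ℝ] (Fin r → ℝ)) '' W = W := hu'
  rw [himg] at h
  have h1 : ENNReal.ofReal |LinearMap.det (u : (Fin r → ℝ) →ₗ[ℝ] (Fin r → ℝ))| = 1 := by
    rw [← ENNReal.mul_eq_right h0 htop]
    exact h.symm
  rw [LinearMap.det_toMatrix']
  exact ENNReal.ofReal_eq_one.1 h1

theorem preimage_smul_eq_of_mem_unitaryGroup {W : Set (Fin r → ℝ)}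
    {u : (Fin r → ℝ) ≃ₗ[ℝ] (Fin r → ℝ)} (hu : u ∈ unitaryGroup W) (D : ℝ) :
    u ⁻¹' (D • W) = D • W := by
  have hu' : u • W = W := hu
  ext v
  have h : u • (D • W) = D • W := by rw [smul_comm, hu']
  change u • v ∈ D • W ↔ _
  rw [← h, Set.smul_mem_smul_set_iff, h]

end Ellipsoid

/-! ### Comparison of the counts and conclusion -/

theorem formOver_injective (K : Type*) [Field K] [Algebra ℚ K] {r : ℕ} :
    Function.Injective (formOver K : Module.Dual ℚ (Fin r → ℚ) → _) := by
  intro L L' h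
  ext x
  have := congrArg (fun ℓ => ℓ (coordEmb K (Pi.single x 1))) h
  simp only [formOver_coordEmb] at this
  simpa using (algebraMap ℚ K).injective this

theorem formOver_zero (K : Type*) [Field K] [Algebra ℚ K] (r : ℕ) :
    formOver K (0 : Module.Dual ℚ (Fin r → ℚ)) = 0 := by
  simp [formOver]

theorem InSingleOrbit.eq_zero {K : Type*} [Field K] [Algebra ℚ K] {r n : ℕ}
    {L : Fin n → Module.Dual ℚ (Fin r → ℚ)} {W : Set (Fin r → K)}
    (h : InSingleOrbit W fun i => formOver K (L i)) {i : Fin n} (hi : L i = 0) (j : Fin n) :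
    L j = 0 := by
  obtain ⟨u, _, e⟩ := h i j
  refine formOver_injective K ?_
  simp only [hi, formOver_zero, LinearMap.zero_comp] at e
  rw [e, formOver_zero]

/-- The factor `D ^ 2` stands on the left so that no negative power of `D` is needed when `m = 0`.
-/
theorem abs_ncard_slice_sub_le {m n : ℕ} {L : Fin n → Module.Dual ℚ (Fin (m + 1) → ℚ)}
    {Λ : Submodule ℤ (Fin (m + 1) → ℚ)} (hΛ : Submodule.IsLattice ℚ Λ)
    {W : Set (Fin (m + 1) → ℝ)} {ε R : ℝ} (hR : 0 ≤ R) (hW : IsConvexBodyAtZero W ε R)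
    (horb : InSingleOrbit W fun i => formOver ℝ (L i)) (i j : Fin n) (hi : L i ≠ 0)
    (hmap : Λ.map ((L i).restrictScalars ℤ) = Λ.map ((L j).restrictScalars ℤ)) :
    ∃ C : ℝ, 0 ≤ C ∧ ∀ D : ℝ, 1 ≤ D → ∀ y : ℚ,
      |({x | (x ∈ Λ ∧ coordEmb ℝ x ∈ D • W) ∧ L i x = y}.ncard : ℝ) -
        ({x | (x ∈ Λ ∧ coordEmb ℝ x ∈ D • W) ∧ L j x = y}.ncard : ℝ)| * D ^ 2 ≤
          C * D ^ (m + 1) := by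
  obtain ⟨g, hg, hgi⟩ := exists_span_singleton_eq_map hΛ hi
  have hgj := hmap ▸ hgi
  obtain ⟨b, hb0, hb⟩ := exists_adapted_basis hΛ hg hgi
  obtain ⟨b', hb0', hb'⟩ := exists_adapted_basis hΛ hg hgj
  have hM := det_latticeMatrix_ne_zero hΛ b
  have hM' := det_latticeMatrix_ne_zero hΛ b'
  obtain ⟨c, hc, hcM⟩ := exists_norm_le_mul_norm_mulVec hM
  obtain ⟨c', hc', hcM'⟩ := exists_norm_le_mul_norm_mulVec hM'
  obtain ⟨u, hu, e⟩ := horb i j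
  set U := LinearMap.toMatrix' (u : (Fin (m + 1) → ℝ) →ₗ[ℝ] (Fin (m + 1) → ℝ))
  have hUv : ∀ v, U.mulVec v = u v := fun v => LinearMap.toMatrix'_mulVec _ v
  have hdet : |U.det * (latticeMatrix b).det| = |(latticeMatrix b').det| := by
    rw [abs_mul, abs_det_eq_one_of_mem_unitaryGroup hW hu, one_mul, abs_det_latticeMatrix_eq b b']
  have hℓ : ∀ v, formOver ℝ (L j) (U.mulVec v) = formOver ℝ (L i) v := by
    intro v
    have e' : formOver ℝ (L j) = (formOver ℝ (L i)).comp (u⁻¹ : _ ≃ₗ[ℝ] _).toLinearMap := e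
    rw [hUv, e']
    change formOver ℝ (L i) (u.symm (u v)) = _
    rw [u.symm_apply_apply]
  -- In the coordinates of either basis the body `D • W` lies in the box of half-side `D * A`.
  set A := max c c' * R
  have hA : 0 ≤ A := by positivity
  refine ⟨2 * (m * (2 * A + 1) ^ (m - 1)), by positivity, fun D hD y => ?_⟩
  have hD0 : 0 < D := one_pos.trans_le hD
  have hWD := hW.smul hD0
  by_cases hy : y ∈ Submodule.span ℤ {g}
  · obtain ⟨t, rfl⟩ := Submodule.mem_span_singleton.1 hy
    rw [ncard_lattice_slice hg hb0 hb, ncard_lattice_slice hg hb0' hb']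
    have hU : U.mulVec ⁻¹' (D • W) = D • W := by
      rw [funext hUv]
      exact preimage_smul_eq_of_mem_unitaryGroup hu D
    have hvol := volume_headSlice_eq hM' hdet hU hℓ (Rat.cast_ne_zero.2 hg)
      (formOver_latticeMatrix_mulVec hb0 hb) (formOver_latticeMatrix_mulVec hb0' hb') t
    have hcount : ∀ (M : Matrix (Fin (m + 1)) (Fin (m + 1)) ℝ) (k : ℝ), 0 < k → k ≤ max c c' →
        (∀ v, ‖v‖ ≤ k * ‖M.mulVec v‖) →
        |((intPoints (headSlice (M.mulVec ⁻¹' (D • W)) t)).ncard : ℝ) -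
          volume.real (headSlice (M.mulVec ⁻¹' (D • W)) t)| ≤
            m * (2 * (D * A) + 1) ^ (m - 1) := by
      intro M k hk hkc hkM
      refine abs_ncard_intPoints_sub_volume_le (by positivity)
        (convex_headSlice (hWD.convex.linear_preimage (Matrix.mulVecLin M)) _)
        (measurableSet_headSlice (measurable_mulVec M hWD.measurableSet) _)
        (headSlice_bound (fun v hv l => (mulVec_preimage_bound hk.le hkM hWD.norm_le v hv l).trans
          ?_) _)
      calc k * (D * R) ≤ max c c' * (D * R) := by gcongr
        _ = D * A := by simp only [A]; ring
    have h1 := hcount _ c hc (le_max_left _ _) hcM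
    have h2 := hcount _ c' hc' (le_max_right _ _) hcM'
    rw [hvol] at h1
    rw [abs_sub_comm] at h2
    have h3 := (abs_sub_le _ _ _).trans (add_le_add h1 h2)
    have h4 : (m : ℝ) * (2 * (D * A) + 1) ^ (m - 1) * D ^ 2 ≤
        m * (2 * A + 1) ^ (m - 1) * D ^ (m + 1) := by
      -- For `m = 0` the exponent `m - 1` is truncated, but the factor `m` makes both sides zero.
      rcases m with _ | m
      · simp
      · have h5 : 2 * (D * A) + 1 ≤ (2 * A + 1) * D := by nlinarith
        simp only [Nat.add_sub_cancel]
        calc ((m + 1 : ℕ) : ℝ) * (2 * (D * A) + 1) ^ m * D ^ 2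
            ≤ ((m + 1 : ℕ) : ℝ) * ((2 * A + 1) * D) ^ m * D ^ 2 := by gcongr
          _ = _ := by rw [mul_pow]; ring
    refine (mul_le_mul_of_nonneg_right h3 (by positivity)).trans ?_
    linarith
  · have hempty : ∀ l : Fin n, Λ.map ((L l).restrictScalars ℤ) = Submodule.span ℤ {g} →
        {x | (x ∈ Λ ∧ coordEmb ℝ x ∈ D • W) ∧ L l x = y} = ∅ := by
      intro l hl
      refine Set.eq_empty_of_forall_notMem ?_
      rintro x ⟨⟨hx, _⟩, rfl⟩
      exact hy (hl ▸ ⟨x, hx, rfl⟩)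
    rw [hempty i hgi, hempty j hgj]
    simp
    positivity

theorem uniformOn_real_eq_ncard_div {α : Type*} [MeasurableSpace α] [MeasurableSingletonClass α]
    {S : Set α} (hS : S.Finite) (P : Set α) :
    (ProbabilityTheory.uniformOn S).real P = ((S ∩ P).ncard : ℝ) / S.ncard := by
  rw [Measure.real, ProbabilityTheory.uniformOn, ProbabilityTheory.cond_apply hS.measurableSet,
    Measure.count_apply_finite _ hS, Measure.count_apply_finite _ (hS.inter_of_left P),
    Set.ncard_eq_toFinset_card S hS, Set.ncard_eq_toFinset_card _ (hS.inter_of_left P)]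
  simp [div_eq_inv_mul]

end NonDet

theorem mainTheorem7 {r n : ℕ} (L : Fin n → Module.Dual ℚ (Fin r → ℚ))
    (Ω : ∀ (p : ℕ) [Fact p.Prime], Submodule ℤ_[p] (Fin r → ℚ_[p]))
    (hΩ_lattice : ∀ (p : ℕ) [Fact p.Prime], Submodule.IsLattice ℚ_[p] (Ω p))
    (hΩ_standard : {p : ℕ | ∃ _ : Fact p.Prime, Ω p ≠ NonDet.standardLattice p r}.Finite)
    (hΩ_orbit : ∀ (p : ℕ) [Fact p.Prime],
      NonDet.InSingleOrbit (Ω p : Set (Fin r → ℚ_[p])) fun i => NonDet.formOver ℚ_[p] (L i))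
    (Q : QuadraticForm ℝ (Fin r → ℝ)) (hQ_pos : Q.PosDef) (hQ_rat : NonDet.IsDefinedOverRat Q)
    (Ωreal : Set (Fin r → ℝ)) (hΩreal : NonDet.IsEllipsoidOf Q Ωreal)
    (hΩreal_orbit : NonDet.InSingleOrbit Ωreal fun i => NonDet.formOver ℝ (L i)) :
    (∀ D : ℝ, 0 < D →
      (NonDet.ratPoints Ω Ωreal D).Finite ∧ (NonDet.ratPoints Ω Ωreal D).Nonempty) ∧
    ∃ C : ℝ, ∀ D : ℝ, 0 < D → ∀ (i j : Fin n) (y : ℚ),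
      |(ProbabilityTheory.uniformOn (NonDet.ratPoints Ω Ωreal D)).real {x | L i x = y} -
        (ProbabilityTheory.uniformOn (NonDet.ratPoints Ω Ωreal D)).real {x | L j x = y}| ≤
          C / D ^ 2 := by
  obtain ⟨ε, R, hR, hW⟩ := hΩreal.exists_isConvexBodyAtZero hQ_pos
  have hΛ := NonDet.isLattice_globalLattice hΩ_lattice hΩ_standard
  set Λ := (NonDet.globalLattice Ω).toIntSubmodule
  have : Module.Free ℤ Λ := Submodule.IsLattice.free ℚ Λ
  have : Module.Finite ℤ Λ := Submodule.IsLattice.finite ℚ Λ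
  let b := Module.finBasisOfFinrankEq ℤ Λ
    ((Submodule.IsLattice.finrank_of_pi ℚ Λ).trans (Fintype.card_fin r))
  have hpts : ∀ D, NonDet.ratPoints Ω Ωreal D =
      {x | x ∈ Λ ∧ NonDet.coordEmb ℝ x ∈ D • Ωreal} := fun D => rfl
  have hfin : ∀ D : ℝ, 0 < D → (NonDet.ratPoints Ω Ωreal D).Finite := fun D hD =>
    NonDet.lattice_inter_finite hΛ b (hW.smul hD).norm_le
  refine ⟨fun D hD => ⟨hfin D hD, 0, zero_mem (NonDet.globalLattice Ω), ?_⟩, ?_⟩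
  · refine (hW.smul hD).ball_subset _ ?_
    have h0 : NonDet.coordEmb ℝ (0 : Fin r → ℚ) = 0 := funext fun k => by simp [NonDet.coordEmb]
    rw [h0, norm_zero]
    exact (hW.smul hD).eps_pos
  obtain ⟨c, hc, hcount⟩ := NonDet.exists_mul_pow_le_ncard_lattice_inter hΛ b
  have hpair : ∀ i j : Fin n, ∃ C : ℝ, 0 ≤ C ∧ ∀ D : ℝ, 0 < D → ∀ y : ℚ,
      |(ProbabilityTheory.uniformOn (NonDet.ratPoints Ω Ωreal D)).real {x | L i x = y} -
        (ProbabilityTheory.uniformOn (NonDet.ratPoints Ω Ωreal D)).real {x | L j x = y}| ≤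
          C / D ^ 2 := by
    intro i j
    by_cases hi : L i = 0
    · exact ⟨0, le_rfl, fun D hD y => by simp [hi, hΩreal_orbit.eq_zero hi j]⟩
    have hj : L j ≠ 0 := fun hj => hi (hΩreal_orbit.eq_zero hj i)
    have hmap := le_antisymm
      (NonDet.map_globalLattice_le hΩ_lattice hΩ_standard hΩ_orbit i j hj)
      (NonDet.map_globalLattice_le hΩ_lattice hΩ_standard hΩ_orbit j i hi)
    obtain ⟨C, hC, h⟩ : ∃ C : ℝ, 0 ≤ C ∧ ∀ D : ℝ, 1 ≤ D → ∀ y : ℚ,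
        |({x | (x ∈ Λ ∧ NonDet.coordEmb ℝ x ∈ D • Ωreal) ∧ L i x = y}.ncard : ℝ) -
          ({x | (x ∈ Λ ∧ NonDet.coordEmb ℝ x ∈ D • Ωreal) ∧ L j x = y}.ncard : ℝ)| * D ^ 2 ≤
            C * D ^ r := by
      rcases r with _ | m
      -- In dimension 0 every form is zero.
      · exact absurd (Subsingleton.elim _ _) hi
      · exact NonDet.abs_ncard_slice_sub_le hΛ hR hW hΩreal_orbit i j hi hmap
    set k := (c * ε) ^ r
    have hk : 0 < k := pow_pos (mul_pos hc hW.eps_pos) r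
    -- `C / k` suffices for `D ≥ 1`. The added 1 covers `D < 1`, where the bound exceeds 1 and so
    -- any difference of probabilities.
    refine ⟨C / k + 1, by positivity, fun D hD y => ?_⟩
    rcases le_or_gt 1 D with hD1 | hD1
    · rw [NonDet.uniformOn_real_eq_ncard_div (hfin D hD),
        NonDet.uniformOn_real_eq_ncard_div (hfin D hD), ← sub_div, abs_div, Nat.abs_cast]
      have hlow : k * D ^ r ≤ ((NonDet.ratPoints Ω Ωreal D).ncard : ℝ) := by
        have := hcount _ _ _ (hW.smul hD).eps_pos (hW.smul hD).norm_le (hW.smul hD).ball_subset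
        refine le_trans (le_of_eq ?_) this
        rw [← mul_pow]
        ring
      have hpos : 0 < k * D ^ r := by positivity
      rw [div_le_div_iff₀ (hpos.trans_le hlow) (by positivity)]
      calc _ ≤ C * D ^ r := h D hD1 y
        _ = C / k * (k * D ^ r) := by field_simp
        _ ≤ (C / k + 1) * (k * D ^ r) := by gcongr; linarith
        _ ≤ _ := by gcongr
    · have h1 : ∀ S : Set (Fin r → ℚ),
          (ProbabilityTheory.uniformOn (NonDet.ratPoints Ω Ωreal D)).real S ∈ Set.Icc (0 : ℝ) 1 :=
        fun S => ⟨measureReal_nonneg, by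
          rw [NonDet.uniformOn_real_eq_ncard_div (hfin D hD)]
          exact div_le_one_of_le₀
            (by exact_mod_cast Set.ncard_le_ncard Set.inter_subset_left (hfin D hD))
            (Nat.cast_nonneg _)⟩
      have h2 := h1 {x | L i x = y}
      have h3 := h1 {x | L j x = y}
      have h4 : (1 : ℝ) ≤ (C / k + 1) / D ^ 2 := by
        rw [le_div_iff₀ (by positivity), one_mul]
        have : D ^ 2 ≤ 1 := pow_le_one₀ hD.le hD1.le
        have : 0 ≤ C / k := by positivity
        linarith
      refine le_trans (abs_le.2 ⟨?_, ?_⟩) h4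
      · linarith [h2.1, h3.2]
      · linarith [h2.2, h3.1]
  choose C hC h using hpair
  -- The constants are nonnegative, so their sum bounds each one, also when `n = 0`.
  refine ⟨∑ i, ∑ j, C i j, fun D hD i j y => (h i j D hD y).trans ?_⟩
  gcongr
  exact (Finset.single_le_sum (fun j _ => hC i j) (Finset.mem_univ j)).trans
    (Finset.single_le_sum (f := fun i => ∑ j, C i j)
      (fun i _ => Finset.sum_nonneg fun j _ => hC i j) (Finset.mem_univ i))
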